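/- Let $a,p,c\in\mathbb N$. For each $N\in\mathbb N$ let group sizes $n_1=n_1(N),\dots,n_a=n_a(N)$ be given with $\sum_{i=1}^a n_i=N$. For groups $i\in\{1,\dots,a\}$ and subjects $j=1,2,\dots$ let $\mathbf z_{ij}=(z_{ij}^{(1)},\dots,z_{ij}^{(c)})'\in\mathbb R^c$ be fixed (nonrandom) covariate vectors and let the outcomes in $\mathbb R^p$ satisfy $$\mathbf Y_{ij}=\boldsymbol\mu_i+\sum_{w=1}^{c}z_{ij}^{(w)}\boldsymbol\nu^{(w)}+\boldsymbol\epsilon_{ij},$$ where $\boldsymbol\mu_i,\boldsymbol\nu^{(w)}\in\mathbb R^p$ are fixed parameters and $\boldsymbol\mu=(\boldsymbol\mu_1',\dots,\boldsymbol\mu_a')'$. With total sample size $N$, the subjects $1\le j\le n_i$ are observed in group $i$. Let $\mathbf X=\bigl(\bigoplus_{i=1}^a\mathbf 1_{n_i},\mathbf Z\bigr)$, where $\mathbf Z$ has the rows $\mathbf z_{ij}'$, let $\tilde{\mathbf X}=\mathbf X\otimes\mathbf I_p$, let $\mathbf Y$ be the stacked vector of the observed $\mathbf Y_{ij}$, and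 let $(\hat{\boldsymbol\mu}',\hat{\boldsymbol\nu}')'=(\tilde{\mathbf X}'\tilde{\mathbf X})^{-1}\tilde{\mathbf X}'\mathbf Y$ be the ordinary least squares estimator. Let $\mathbf u_{ij}=\mathbf Y_{ij}-\hat{\boldsymbol\mu}_i-\sum_w z_{ij}^{(w)}\hat{\boldsymbol\nu}^{(w)}$ be the residuals, let $\hat{\mathbf S}=\bigoplus_{i}\bigoplus_{j}\mathbf u_{ij}\mathbf u_{ij}'$, and let $\hat{\boldsymbol\Sigma}$ be the upper-left $ap\times ap$ block of the White estimator $(\tilde{\mathbf X}'\tilde{\mathbf X})^{-1}\tilde{\mathbf X}'\hat{\mathbf S}\tilde{\mathbf X}(\tilde{\mathbf X}'\tilde{\mathbf X})^{-1}$. Let $\mathbf H$ be a real matrix with $ap$ columns (for instance a contrast matrix), let $\mathbf T=\mathbf H'(\mathbf H\mathbf H')^{+}\mathbf H$, where $^{+}$ is the Moore–Penrose inverse, and let $$W(\mathbf T)=\hat{\boldsymbol\mu}'\mathbf T'(\mathbf T\hat{\boldsymbol\Sigma}\mathbf T)^{+}\mathbf T\hat{\boldsymbol\mu}.$$ Assume,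 all limits being for $N\to\infty$: 1. The errors $\boldsymbol\epsilon_{ij}$ are independent, with $E[\boldsymbol\epsilon_{ij}]=\mathbf 0$, $\mathrm{Cov}[\boldsymbol\epsilon_{ij}]=\boldsymbol\Sigma_i$ and $E[\epsilon_{ijk}^4]\le C_1<\infty$ for all $i,j,k$, with $C_1$ not depending on $i,j,k$. 2. $\boldsymbol\Sigma_i$ is positive definite for every $i$. 3. $N/n_i\to\kappa_i\in(0,\infty)$ for every $i$. 4. For all sufficiently large $N$ the columns of $\mathbf X$ are linearly independent, and the limit of $N^{-1}\mathbf X'\mathbf X$ (which exists by 3, 5 and 6) is nonsingular. 5. $\frac1{n_i}\sum_{j=1}^{n_i}z_{ij}^{(w)}\to c_i^{(w)}\in\mathbb R$ for all $i,w$. 6. $\frac1{n_i}\sum_{j=1}^{n_i}\mathbf z_{ij}\mathbf z_{ij}'\to\boldsymbol\Xi_i\in\mathbb R^{c\times c}$ for all $i$. Then, under $H_0:\mathbf T\boldsymbol\mu=\mathbf 0$, the Wald-type statistic $W(\mathbf T)$ converges in distribution to the $\chi^2_f$ distribution with $f=\mathrm{rank}(\mathbf T)$ as $N\to\infty$ (where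 $\chi^2_0$ is the point mass at $0$). -/

import Mathlib

open MeasureTheory ProbabilityTheory Filter Topology
open scoped Matrix Kronecker

noncomputable section

namespace Mancova

/-! ### Moore–Penrose inverse of a real matrix -/

/-- `B` satisfies the four Penrose equations for the real matrix `A`. -/
structure IsMoorePenrose {m n : Type*} [Fintype m] [Fintype n]
    (A : Matrix m n ℝ) (B : Matrix n m ℝ) : Prop where
  mul_mul_left : A * B * A = A
  mul_mul_right : B * A * B = B
  symm_left : (A * B)ᵀ = A * B
  symm_right : (B * A)ᵀ = B * A

theorem exists_isMoorePenrose {m n : Type*} [Fintype m] [Fintype n] [DecidableEq n]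
    (A : Matrix m n ℝ) : ∃ B : Matrix n m ℝ, IsMoorePenrose A B := by
  obtain ⟨G, hG⟩ : ∃ G, G = Aᵀ * A := ⟨_, rfl⟩
  have hGh : IsSelfAdjoint G := by
    rw [hG]; exact Matrix.isHermitian_conjTranspose_mul_self A
  have hGt : Gᵀ = G := by rw [hG]; simp
  have hfin : (spectrum ℝ G).Finite := Matrix.finite_real_spectrum
  have hc : ∀ f : ℝ → ℝ, ContinuousOn f (spectrum ℝ G) := fun f => hfin.continuousOn f
  obtain ⟨Q, hQ⟩ : ∃ Q, Q = cfc (fun x : ℝ => x⁻¹) G := ⟨_, rfl⟩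
  have hQt : Qᵀ = Q := by
    have h : IsSelfAdjoint Q := hQ ▸ cfc_predicate _ _
    simpa [IsSelfAdjoint, Matrix.star_eq_conjTranspose] using h
  have hid : cfc (fun x : ℝ => x) G = G := cfc_id' ℝ G
  have hQG : Q * G = cfc (fun x : ℝ => x⁻¹ * x) G := by
    rw [cfc_mul _ _ G (hc _) (hc _), hid, hQ]
  have hGQ : G * Q = cfc (fun x : ℝ => x * x⁻¹) G := by
    rw [cfc_mul _ _ G (hc _) (hc _), hid, hQ]
  have hcomm : G * Q = Q * G := by
    rw [hQG, hGQ]; simp only [mul_comm]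
  have hGQG : G * Q * G = G := by
    have h : G * Q * G = cfc (fun x : ℝ => x * x⁻¹ * x) G := by
      rw [cfc_mul _ _ G (hc _) (hc _), hid, hGQ]
    rw [h]; simpa using hid
  have hQGQ : Q * G * Q = Q := by
    have h : Q * G * Q = cfc (fun x : ℝ => x⁻¹ * x * x⁻¹) G := by
      rw [cfc_mul _ _ G (hc _) (hc _), hQG, hQ]
    rw [h, hQ]
    congr 1
    funext x
    rcases eq_or_ne x 0 with rfl | hx
    · simp
    · field_simp
  have hAQG : A * (Q * G - 1) = 0 := by
    rw [← Matrix.conjTranspose_mul_self_eq_zero, Matrix.conjTranspose_eq_transpose_of_trivial,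
      Matrix.transpose_mul, Matrix.transpose_sub, Matrix.transpose_mul, hGt, hQt,
      Matrix.transpose_one, Matrix.mul_assoc, ← Matrix.mul_assoc Aᵀ, ← hG, ← Matrix.mul_assoc,
      Matrix.sub_mul, Matrix.one_mul, hGQG, sub_self, Matrix.zero_mul]
  refine ⟨Q * Aᵀ, ?_, ?_, ?_, ?_⟩
  · rw [Matrix.mul_sub, Matrix.mul_one, sub_eq_zero] at hAQG
    rw [Matrix.mul_assoc, Matrix.mul_assoc, ← hG, hAQG]
  · rw [Matrix.mul_assoc Q, ← hG, ← Matrix.mul_assoc, hQGQ]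
  · rw [Matrix.transpose_mul, Matrix.transpose_mul, Matrix.transpose_transpose, hQt,
      Matrix.mul_assoc]
  · rw [Matrix.mul_assoc, ← hG, Matrix.transpose_mul, hGt, hQt, hcomm]

theorem IsMoorePenrose.unique {m n : Type*} [Fintype m] [Fintype n]
    {A : Matrix m n ℝ} {B C : Matrix n m ℝ} (hB : IsMoorePenrose A B)
    (hC : IsMoorePenrose A C) : B = C := by
  have h1 : A * B = A * C := by
    have h : (A * B)ᵀ = (A * C * (A * B))ᵀ := by
      rw [← Matrix.mul_assoc, hC.mul_mul_left]
    rw [Matrix.transpose_mul (A * C), hB.symm_left, hC.symm_left, ← Matrix.mul_assoc,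
      hB.mul_mul_left] at h
    exact h
  have h2 : B * A = C * A := by
    have h : (B * A)ᵀ = (B * A * (C * A))ᵀ := by
      rw [Matrix.mul_assoc, ← Matrix.mul_assoc A, hC.mul_mul_left]
    rw [Matrix.transpose_mul (B * A), hB.symm_right, hC.symm_right, Matrix.mul_assoc,
      ← Matrix.mul_assoc A, hB.mul_mul_left] at h
    exact h
  rw [← hB.mul_mul_right, h2, Matrix.mul_assoc, h1, ← Matrix.mul_assoc, hC.mul_mul_right]

/-- The Moore–Penrose inverse `A⁺` of a real matrix. -/
def pinv {m n : Type*} [Fintype m] [Fintype n] [DecidableEq n]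
    (A : Matrix m n ℝ) : Matrix n m ℝ :=
  (exists_isMoorePenrose A).choose

theorem pinv_spec {m n : Type*} [Fintype m] [Fintype n] [DecidableEq n]
    (A : Matrix m n ℝ) : IsMoorePenrose A (pinv A) :=
  (exists_isMoorePenrose A).choose_spec

/-! ### Hypothesis matrix and chi-squared distribution -/

/-- The projector `T = H' (H H')⁺ H` belonging to the matrix `H`. -/
def hypProj {q : ℕ} {ι : Type*} [Fintype ι] (H : Matrix (Fin q) ι ℝ) : Matrix ι ι ℝ :=
  Hᵀ * pinv (H * Hᵀ) * H

/-- The (central) chi-squared distribution with `f` degrees of freedom: the law of the sum of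
the squares of `f` independent standard normal variables (the point mass at `0` if `f = 0`). -/
def chiSquared (f : ℕ) : Measure ℝ :=
  (Measure.pi fun _ : Fin f => gaussianReal 0 1).map fun x => ∑ i, x i ^ 2

instance isProbabilityMeasure_chiSquared (f : ℕ) : IsProbabilityMeasure (chiSquared f) :=
  Measure.isProbabilityMeasure_map
    (Measurable.aemeasurable (by fun_prop))

/-! ### Design, least squares and the Wald-type statistic

`a` groups, `p`-dimensional outcomes, `c` covariates.  The first `n i` subjects of each group `i`
are observed; `z i j w` is the `w`-th covariate and `y i j k` the `k`-th outcome component of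
subject `j` in group `i`. -/

/-- The observed subjects `(i, j)`, where `j < n i`. -/
abbrev Subject {a : ℕ} (n : Fin a → ℕ) : Type := (i : Fin a) × Fin (n i)

/-- The design matrix `X = (⊕ᵢ 1_{nᵢ}, Z)`. -/
def design {a c : ℕ} (n : Fin a → ℕ) (z : Fin a → ℕ → Fin c → ℝ) :
    Matrix (Subject n) (Fin a ⊕ Fin c) ℝ :=
  Matrix.fromCols (Matrix.of fun s i => if s.1 = i then 1 else 0)
    (Matrix.of fun s w => z s.1 s.2 w)

/-- The full design matrix `X̃ = (M̃, Z̃) = X ⊗ I_p` of the vectorized model. -/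
def fullDesign {a c : ℕ} (p : ℕ) (n : Fin a → ℕ) (z : Fin a → ℕ → Fin c → ℝ) :
    Matrix (Subject n × Fin p) ((Fin a ⊕ Fin c) × Fin p) ℝ :=
  design n z ⊗ₖ (1 : Matrix (Fin p) (Fin p) ℝ)

/-- The ordinary least squares estimator `(X̃'X̃)⁻¹ X̃'Y` of `(μ, ν)`. -/
def ols {a c p : ℕ} (n : Fin a → ℕ) (z : Fin a → ℕ → Fin c → ℝ) (y : Fin a → ℕ → Fin p → ℝ) :
    (Fin a ⊕ Fin c) × Fin p → ℝ :=
  (((fullDesign p n z)ᵀ * fullDesign p n z)⁻¹ * (fullDesign p n z)ᵀ) *ᵥ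
    fun s => y s.1.1 s.1.2 s.2

/-- The least squares estimator of the adjusted means. -/
def muHat {a c p : ℕ} (n : Fin a → ℕ) (z : Fin a → ℕ → Fin c → ℝ) (y : Fin a → ℕ → Fin p → ℝ) :
    Fin a × Fin p → ℝ :=
  fun r => ols n z y (Sum.inl r.1, r.2)

/-- The least squares estimator of the regression coefficients. -/
def nuHat {a c p : ℕ} (n : Fin a → ℕ) (z : Fin a → ℕ → Fin c → ℝ) (y : Fin a → ℕ → Fin p → ℝ) :
    Fin c × Fin p → ℝ :=
  fun r => ols n z y (Sum.inr r.1, r.2)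

/-- The residual vectors `u_{ij} = Y_{ij} - μ̂_i - ∑_w z_{ij}^{(w)} ν̂^{(w)}`. -/
def residual {a c p : ℕ} (n : Fin a → ℕ) (z : Fin a → ℕ → Fin c → ℝ)
    (y : Fin a → ℕ → Fin p → ℝ) (s : Subject n) (k : Fin p) : ℝ :=
  y s.1 s.2 k - muHat n z y (s.1, k) - ∑ w, z s.1 s.2 w * nuHat n z y (w, k)

/-- The block diagonal matrix `Ŝ` with the blocks `u_{ij} u_{ij}'`. -/
def SHat {a c p : ℕ} (n : Fin a → ℕ) (z : Fin a → ℕ → Fin c → ℝ) (y : Fin a → ℕ → Fin p → ℝ) :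
    Matrix (Subject n × Fin p) (Subject n × Fin p) ℝ :=
  Matrix.of fun s t =>
    if s.1 = t.1 then residual n z y s.1 s.2 * residual n z y t.1 t.2 else 0

/-- The multivariate White covariance matrix estimator
`(X̃'X̃)⁻¹ X̃' Ŝ X̃ (X̃'X̃)⁻¹` for the full least squares estimator. -/
def whiteFull {a c p : ℕ} (n : Fin a → ℕ) (z : Fin a → ℕ → Fin c → ℝ)
    (y : Fin a → ℕ → Fin p → ℝ) :
    Matrix ((Fin a ⊕ Fin c) × Fin p) ((Fin a ⊕ Fin c) × Fin p) ℝ :=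
  ((fullDesign p n z)ᵀ * fullDesign p n z)⁻¹ * (fullDesign p n z)ᵀ * SHat n z y *
    fullDesign p n z * ((fullDesign p n z)ᵀ * fullDesign p n z)⁻¹

/-- The estimator `Σ̂`: the upper-left (adjusted means) block of the White estimator. -/
def sigmaHat {a c p : ℕ} (n : Fin a → ℕ) (z : Fin a → ℕ → Fin c → ℝ)
    (y : Fin a → ℕ → Fin p → ℝ) : Matrix (Fin a × Fin p) (Fin a × Fin p) ℝ :=
  (whiteFull n z y).submatrix (fun r => (Sum.inl r.1, r.2)) (fun r => (Sum.inl r.1, r.2))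

/-- The Wald-type statistic `W(T) = μ̂' T' (T Σ̂ T)⁺ T μ̂`. -/
def wald {a c p : ℕ} (T : Matrix (Fin a × Fin p) (Fin a × Fin p) ℝ) (n : Fin a → ℕ)
    (z : Fin a → ℕ → Fin c → ℝ) (y : Fin a → ℕ → Fin p → ℝ) : ℝ :=
  muHat n z y ⬝ᵥ ((Tᵀ * pinv (T * sigmaHat n z y * T) * T) *ᵥ muHat n z y)

/-- The limit of `N⁻¹ X'X`, when `N / nᵢ → κᵢ`, the covariate means in group `i` converge to
`m i` and the covariate second moment matrices in group `i` converge to `Ξ i`. -/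
def limitGram {a c : ℕ} (κ : Fin a → ℝ) (m : Fin a → Fin c → ℝ)
    (Ξ : Fin a → Matrix (Fin c) (Fin c) ℝ) : Matrix (Fin a ⊕ Fin c) (Fin a ⊕ Fin c) ℝ :=
  Matrix.fromBlocks (Matrix.diagonal fun i => (κ i)⁻¹) (Matrix.of fun i w => (κ i)⁻¹ * m i w)
    (Matrix.of fun w i => (κ i)⁻¹ * m i w) (∑ i, (κ i)⁻¹ • Ξ i)

end Mancova

end

/-! Under the model, `μ̂ - μ` is a linear combination of the errors with coefficients from
`(X'X)⁻¹X'`. The covariates enter only through the group Gram matrices: once `N⁻¹ groupGram`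
converges to `Γ i` for each group, `N (X'X)⁻¹` converges, and so does the covariance of `√N (μ̂ -
μ)`. Its limit `V = limitCovMean Γ Sig` is positive definite (`posDef_limitCov`).

The covariates of a group form one sequence that does not depend on `N`. Convergence of their
averaged squares therefore forces every squared entry of `X` to be uniformly `o(N)`
(`eventually_forall_lt_le_mul`), so the squared coefficients times `N` and the leverages vanish
uniformly (`eventually_lsCoef_sq_le`, `eventually_leverage_le`). This negligibility serves twice. It
gives Lyapunov's condition for the central limit theorem (`tendsto_charFun_sum`,
`tendstoInDistribution_normalizedError`). It also makes the White estimator consistent, `N Σ̂ → V`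
in probability: residuals may be replaced by errors, and a weighted law of large numbers holds in
`L¹` (`integral_abs_weighted_residual_le`, `tendstoInMeasure_sigmaHat`).

The remaining obstacle is that the Moore–Penrose inverse is discontinuous. Since `T` is an
orthogonal projector of rank `f`, there is a matrix `L` with `f` rows, `L V L' = 1` and `L T = L`,
such that `T (T R T)⁺ T = L' (L R L')⁻¹ L` as soon as `L R L'` is invertible (`exists_whitening`).
Because `L (N Σ̂) L' → 1` in probability, the event of invertibility has probability tending to one.
On it, under the null hypothesis, the statistic is a quadratic form in `√N L (μ̂ - μ)` whose matrix
tends to the identity (`wald_eq_quadraticForm`). Slutsky's theorem then gives the squared norm of a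
standard Gaussian vector in dimension `f`. -/

noncomputable section

namespace Mancova

/-! ### Measurability of matrix inverses, orthogonal projectors and whitening -/

section LinearAlgebra

theorem measurable_det {α n : Type*} [MeasurableSpace α] [Fintype n] [DecidableEq n]
    {A : α → Matrix n n ℝ} (hA : ∀ i j, Measurable fun x => A x i j) :
    Measurable fun x => (A x).det := by
  simp only [Matrix.det_apply]
  exact Finset.measurable_sum _ fun σ _ =>
    (Finset.measurable_prod _ fun i _ => hA _ _).const_smul _

/-- Cramer's rule makes each entry a quotient of determinants. The convention that singular matrices
have inverse `0` agrees with `0⁻¹ = 0`, so no invertibility is needed. -/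
theorem measurable_inv_apply {α n : Type*} [MeasurableSpace α] [Fintype n] [DecidableEq n]
    {A : α → Matrix n n ℝ} (hA : ∀ i j, Measurable fun x => A x i j) (i j : n) :
    Measurable fun x => (A x)⁻¹ i j := by
  simp only [Matrix.inv_def, Matrix.smul_apply, Ring.inverse_eq_inv', smul_eq_mul,
    Matrix.adjugate_apply]
  refine (measurable_det hA).inv.mul (measurable_det fun k l => ?_)
  by_cases hk : k = j
  · subst hk; simp
  · simpa [Matrix.updateRow_apply, hk] using hA k l

theorem measurable_mul_apply {α l m n : Type*} [MeasurableSpace α] [Fintype m]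
    {A : α → Matrix l m ℝ} {B : α → Matrix m n ℝ}
    (hA : ∀ i j, Measurable fun x => A x i j) (hB : ∀ i j, Measurable fun x => B x i j)
    (i : l) (j : n) : Measurable fun x => (A x * B x) i j := by
  simp only [Matrix.mul_apply]
  exact Finset.measurable_sum _ fun k _ => (hA _ _).mul (hB _ _)

theorem continuousAt_matrix_inv {n : Type*} [Fintype n] [DecidableEq n] {A : Matrix n n ℝ}
    (hA : A.det ≠ 0) : ContinuousAt (fun B : Matrix n n ℝ => B⁻¹) A := by
  simp only [Matrix.inv_def, Ring.inverse_eq_inv']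
  exact (ContinuousAt.inv₀ (Continuous.matrix_det continuous_id).continuousAt hA).smul
    (Continuous.matrix_adjugate continuous_id).continuousAt

theorem posDef_one_add_smul_gram {m n : Type*} [Fintype m] [Fintype n] [DecidableEq n]
    (A : Matrix m n ℝ) {δ : ℝ} (hδ : 0 < δ) : (Aᵀ * A + δ • (1 : Matrix n n ℝ)).PosDef := by
  have h := Matrix.posSemidef_conjTranspose_mul_self A
  rw [Matrix.conjTranspose_eq_transpose_of_trivial] at h
  exact Matrix.PosDef.posSemidef_add h (Matrix.PosDef.one.smul hδ)

/-- Tikhonov regularization converges to the Moore–Penrose inverse. -/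
theorem tendsto_regularized_inv {m n : Type*} [Fintype m] [Fintype n] [DecidableEq m]
    [DecidableEq n] (A : Matrix m n ℝ) :
    Tendsto (fun k : ℕ => (Aᵀ * A + (1 / ((k : ℝ) + 1)) • (1 : Matrix n n ℝ))⁻¹ * Aᵀ) atTop
      (𝓝 (pinv A)) := by
  have hB := pinv_spec A
  set B := pinv A
  have h1 : Aᵀ * A * B = Aᵀ := by
    rw [Matrix.mul_assoc, ← hB.symm_left, ← Matrix.transpose_mul, hB.mul_mul_left]
  have h2 : Aᵀ * (Bᵀ * B) = B := by
    rw [← Matrix.mul_assoc, ← Matrix.transpose_mul, hB.symm_right, hB.mul_mul_right]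
  have h0 : Tendsto (fun k : ℕ => 1 + (1 / ((k : ℝ) + 1)) • (Bᵀ * B)) atTop
      (𝓝 (1 : Matrix m m ℝ)) := by
    have := (tendsto_const_nhds (x := (1 : Matrix m m ℝ))).add
      ((tendsto_one_div_add_atTop_nhds_zero_nat (𝕜 := ℝ)).smul_const (Bᵀ * B))
    simpa using this
  have h3 : Tendsto (fun k : ℕ => B * (1 + (1 / ((k : ℝ) + 1)) • (Bᵀ * B))⁻¹) atTop (𝓝 B) := by
    have := ((continuousAt_matrix_inv (A := (1 : Matrix m m ℝ)) (by simp)).tendsto.comp h0)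
    have h4 := ((continuous_const (y := B)).matrix_mul continuous_id).continuousAt.tendsto.comp
      this
    simpa [Function.comp_def] using h4
  refine h3.congr fun k => ?_
  have hk : (0 : ℝ) < 1 / ((k : ℝ) + 1) := by positivity
  set δ : ℝ := 1 / ((k : ℝ) + 1)
  have hu := (posDef_one_add_smul_gram A hk).isUnit
  have hv : IsUnit (1 + δ • (Bᵀ * B)) := by
    have hp : (1 + δ • (Bᵀ * B)).PosDef := by
      have h := Matrix.posSemidef_conjTranspose_mul_self B
      rw [Matrix.conjTranspose_eq_transpose_of_trivial] at h
      exact Matrix.PosDef.one.add_posSemidef (h.smul hk.le)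
    exact hp.isUnit
  rw [Matrix.isUnit_iff_isUnit_det] at hu hv
  -- By `AᵀAB = Aᵀ` and `AᵀBᵀB = B`, the regularized inverse equals `B (1 + δ BᵀB)⁻¹`, which is
  -- continuous at `δ = 0` although `AᵀA` may be singular.
  have hkey : (Aᵀ * A + δ • (1 : Matrix n n ℝ)) * B = Aᵀ * (1 + δ • (Bᵀ * B)) := by
    rw [Matrix.add_mul, h1, Matrix.mul_add, Matrix.mul_smul, h2, Matrix.smul_mul, Matrix.one_mul,
      Matrix.mul_one]
  calc B * (1 + δ • (Bᵀ * B))⁻¹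
      = (Aᵀ * A + δ • (1 : Matrix n n ℝ))⁻¹ * ((Aᵀ * A + δ • (1 : Matrix n n ℝ)) * B) *
          (1 + δ • (Bᵀ * B))⁻¹ := by rw [Matrix.nonsing_inv_mul_cancel_left _ _ hu]
    _ = _ := by
      rw [hkey, Matrix.mul_assoc, Matrix.mul_nonsing_inv_cancel_right _ _ hv]

/-- The Moore–Penrose inverse jumps where the rank changes, so continuity cannot be used; it is
instead a pointwise limit of the measurable Tikhonov regularizations. -/
theorem measurable_pinv_apply {α m n : Type*} [MeasurableSpace α] [Fintype m] [Fintype n]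
    [DecidableEq m] [DecidableEq n] {A : α → Matrix m n ℝ}
    (hA : ∀ i j, Measurable fun x => A x i j) (i : n) (j : m) :
    Measurable fun x => pinv (A x) i j := by
  have hAt : ∀ i j, Measurable fun x => (A x)ᵀ i j := fun i j => hA j i
  refine measurable_of_tendsto_metrizable (f := fun (k : ℕ) x =>
    (((A x)ᵀ * A x + (1 / ((k : ℝ) + 1)) • (1 : Matrix n n ℝ))⁻¹ * (A x)ᵀ) i j) (fun k => ?_) ?_
  · refine measurable_mul_apply (measurable_inv_apply fun i j => ?_) hAt i j
    simp only [Matrix.add_apply]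
    exact (measurable_mul_apply hAt hA i j).add_const _
  · rw [tendsto_pi_nhds]
    intro x
    exact ((continuous_apply j).comp (continuous_apply i)).continuousAt.tendsto.comp
      (tendsto_regularized_inv (A x))

theorem pinv_transpose {m n : Type*} [Fintype m] [Fintype n] [DecidableEq m] [DecidableEq n]
    (A : Matrix m n ℝ) : (pinv A)ᵀ = pinv Aᵀ := by
  have h := pinv_spec A
  refine IsMoorePenrose.unique (A := Aᵀ) ⟨?_, ?_, ?_, ?_⟩ (pinv_spec Aᵀ)
  · rw [← Matrix.transpose_mul, ← Matrix.transpose_mul, ← Matrix.mul_assoc, h.mul_mul_left]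
  · rw [← Matrix.transpose_mul, ← Matrix.transpose_mul, ← Matrix.mul_assoc, h.mul_mul_right]
  · rw [← Matrix.transpose_mul, h.symm_right, h.symm_right]
  · rw [← Matrix.transpose_mul, h.symm_left, h.symm_left]

theorem hypProj_transpose {q : ℕ} {ι : Type*} [Fintype ι] (H : Matrix (Fin q) ι ℝ) :
    (hypProj H)ᵀ = hypProj H := by
  simp [hypProj, Matrix.transpose_mul, pinv_transpose, Matrix.mul_assoc]

theorem hypProj_mul_self {q : ℕ} {ι : Type*} [Fintype ι] (H : Matrix (Fin q) ι ℝ) :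
    hypProj H * hypProj H = hypProj H := by
  have h := (pinv_spec (H * Hᵀ)).mul_mul_right
  calc hypProj H * hypProj H = Hᵀ * (pinv (H * Hᵀ) * (H * Hᵀ) * pinv (H * Hᵀ)) * H := by
        simp only [hypProj, Matrix.mul_assoc]
    _ = hypProj H := by rw [h, hypProj]

/-- An orthogonal projector is `E E'`, where the columns of `E` are an orthonormal basis of its
range. -/
theorem exists_orthonormal_factor {ι : Type*} [Fintype ι] [DecidableEq ι] {T : Matrix ι ι ℝ}
    (hT : Tᵀ = T) (hTT : T * T = T) :
    ∃ E : Matrix ι (Fin T.rank) ℝ, Eᵀ * E = 1 ∧ E * Eᵀ = T := by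
  let K : Submodule ℝ (EuclideanSpace ℝ ι) := LinearMap.range (Matrix.toEuclideanLin T)
  have hK : Module.finrank ℝ K = T.rank := by
    rw [Matrix.rank_eq_finrank_range_toLin T (EuclideanSpace.basisFun ι ℝ).toBasis
      (EuclideanSpace.basisFun ι ℝ).toBasis]
    rfl
  let b : OrthonormalBasis (Fin T.rank) ℝ K := (stdOrthonormalBasis ℝ K).reindex (finCongr hK)
  let E : Matrix ι (Fin T.rank) ℝ := Matrix.of fun i r => (b r : EuclideanSpace ℝ ι) i
  have hfix : ∀ v : K, T *ᵥ (v : EuclideanSpace ℝ ι).ofLp = (v : EuclideanSpace ℝ ι).ofLp := by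
    rintro ⟨v, w, rfl⟩
    simp [Matrix.toLpLin_apply, Matrix.mulVec_mulVec, hTT]
  have hE1 : Eᵀ * E = 1 := by
    ext r s
    have h := (orthonormal_iff_ite.mp b.orthonormal) r s
    rw [Submodule.coe_inner, EuclideanSpace.inner_eq_star_dotProduct] at h
    simp only [star_trivial] at h
    rw [Matrix.one_apply, ← h, Matrix.mul_apply, dotProduct_comm]
    rfl
  have hTE : T * E = E := by
    ext i r
    exact congrFun (hfix (b r)) i
  have hET : E * Eᵀ * T = T := by
    refine Matrix.toEuclideanLin.injective (LinearMap.ext fun w => ?_)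
    have hv := b.sum_repr' ⟨Matrix.toEuclideanLin T w, w, rfl⟩
    have hv2 := congrArg (Subtype.val) hv
    simp only [Submodule.coe_sum, Submodule.coe_smul, Submodule.coe_inner] at hv2
    rw [← hv2]
    ext i
    rw [Matrix.mul_assoc]
    simp only [Matrix.toLpLin_apply, ← Matrix.mulVec_mulVec]
    simp [Matrix.mulVec, dotProduct, E, EuclideanSpace.inner_eq_star_dotProduct, mul_comm]
  refine ⟨E, hE1, ?_⟩
  -- Transposing `E Eᵀ T = T` gives `T E Eᵀ = T`, and `T E = E` reduces the left side to `E Eᵀ`.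
  have := congrArg Matrix.transpose hET
  rw [Matrix.transpose_mul, Matrix.transpose_mul, Matrix.transpose_transpose, hT,
    ← Matrix.mul_assoc, hTE] at this
  exact this

open scoped MatrixOrder Matrix.Norms.L2Operator in
theorem exists_posDef_factor {n : Type*} [Fintype n] [DecidableEq n] {S : Matrix n n ℝ}
    (hS : S.PosDef) : ∃ B : Matrix n n ℝ, IsUnit B.det ∧ S = Bᵀ * B := by
  obtain ⟨B, hB⟩ := CStarAlgebra.nonneg_iff_eq_star_mul_self.mp hS.posSemidef.nonneg
  rw [Matrix.star_eq_conjTranspose, Matrix.conjTranspose_eq_transpose_of_trivial] at hB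
  refine ⟨B, isUnit_iff_ne_zero.mpr fun h => hS.det_pos.ne' ?_, hB⟩
  rw [hB, Matrix.det_mul, h, mul_zero]

/-- Whitening of a positive definite matrix on the range of an orthogonal projector, and the
Moore–Penrose inverse of a compression to that range. -/
theorem exists_whitening {ι : Type*} [Fintype ι] [DecidableEq ι] {T S : Matrix ι ι ℝ}
    (hT : Tᵀ = T) (hTT : T * T = T) (hS : S.PosDef) :
    ∃ L : Matrix (Fin T.rank) ι ℝ, L * S * Lᵀ = 1 ∧ L * T = L ∧
      ∀ R : Matrix ι ι ℝ, (L * R * Lᵀ).det ≠ 0 →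
        Tᵀ * pinv (T * R * T) * T = Lᵀ * (L * R * Lᵀ)⁻¹ * L := by
  obtain ⟨E, hE1, hE2⟩ := exists_orthonormal_factor hT hTT
  have hinj : Function.Injective E.mulVec := by
    intro v w hvw
    have := congrArg (Eᵀ *ᵥ ·) hvw
    simpa [Matrix.mulVec_mulVec, hE1] using this
  have hES : (Eᵀ * S * E).PosDef := by
    have := hS.conjTranspose_mul_mul_same hinj
    rwa [Matrix.conjTranspose_eq_transpose_of_trivial] at this
  obtain ⟨B, hB, hBS⟩ := exists_posDef_factor hES
  have hBt : IsUnit Bᵀ.det := by rwa [Matrix.det_transpose]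
  -- With `Eᵀ S E = Bᵀ B`, the choice `L = (Bᵀ)⁻¹ Eᵀ` turns `S` into the identity.
  set C := (Bᵀ)⁻¹ with hC
  have hCt : Cᵀ = B⁻¹ := by rw [hC, Matrix.transpose_nonsing_inv, Matrix.transpose_transpose]
  have hCdet : IsUnit C.det := Matrix.isUnit_nonsing_inv_det _ hBt
  have hCtdet : IsUnit Cᵀ.det := by rwa [Matrix.det_transpose]
  have hTE : T * E = E := by
    have h : E * Eᵀ * E = E := by rw [Matrix.mul_assoc, hE1, Matrix.mul_one]
    rwa [hE2] at h
  have hET : Eᵀ * T = Eᵀ := by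
    have h : Eᵀ * (E * Eᵀ) = Eᵀ := by rw [← Matrix.mul_assoc, hE1, Matrix.one_mul]
    rwa [hE2] at h
  refine ⟨C * Eᵀ, ?_, ?_, fun R hR => ?_⟩
  · calc C * Eᵀ * S * (C * Eᵀ)ᵀ = C * (Eᵀ * S * E) * Cᵀ := by
          simp only [Matrix.transpose_mul, Matrix.transpose_transpose, Matrix.mul_assoc]
      _ = 1 := by
        rw [hBS, hCt, hC, Matrix.nonsing_inv_mul_cancel_left _ _ hBt, Matrix.mul_nonsing_inv _ hB]
  · rw [Matrix.mul_assoc, hET]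
  · set M := Eᵀ * R * E with hM
    have hLR : C * Eᵀ * R * (C * Eᵀ)ᵀ = C * M * Cᵀ := by
      simp only [hM, Matrix.transpose_mul, Matrix.transpose_transpose, Matrix.mul_assoc]
    rw [hLR, Matrix.det_mul, Matrix.det_mul] at hR
    have hMdet : IsUnit M.det := isUnit_iff_ne_zero.mpr fun h => hR (by simp [h])
    have hTRT : T * R * T = E * M * Eᵀ := by
      calc T * R * T = (E * Eᵀ) * R * (E * Eᵀ) := by rw [hE2]
        _ = _ := by rw [hM]; simp only [Matrix.mul_assoc]
    -- In the orthonormal coordinates `E` the matrix `T R T` is the invertible block `M`, so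
    -- inverting that block yields the pseudoinverse; uniqueness identifies the two.
    have hMP : IsMoorePenrose (T * R * T) (E * M⁻¹ * Eᵀ) := by
      rw [hTRT]
      have h1 : E * M * Eᵀ * (E * M⁻¹ * Eᵀ) = E * Eᵀ := by
        calc _ = E * (M * (Eᵀ * E) * M⁻¹) * Eᵀ := by simp only [Matrix.mul_assoc]
          _ = _ := by rw [hE1, Matrix.mul_one, Matrix.mul_nonsing_inv _ hMdet, Matrix.mul_one]
      have h2 : E * M⁻¹ * Eᵀ * (E * M * Eᵀ) = E * Eᵀ := by
        calc _ = E * (M⁻¹ * (Eᵀ * E) * M) * Eᵀ := by simp only [Matrix.mul_assoc]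
          _ = _ := by rw [hE1, Matrix.mul_one, Matrix.nonsing_inv_mul _ hMdet, Matrix.mul_one]
      refine ⟨?_, ?_, ?_, ?_⟩
      · rw [h1, ← Matrix.mul_assoc, ← Matrix.mul_assoc, Matrix.mul_assoc E, hE1, Matrix.mul_one]
      · rw [h2, ← Matrix.mul_assoc, ← Matrix.mul_assoc, Matrix.mul_assoc E, hE1, Matrix.mul_one]
      · rw [h1, hE2, hT]
      · rw [h2, hE2, hT]
    rw [(pinv_spec (T * R * T)).unique hMP, hT, hLR, Matrix.mul_inv_rev, Matrix.mul_inv_rev]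
    calc T * (E * M⁻¹ * Eᵀ) * T = (T * E) * M⁻¹ * (Eᵀ * T) := by simp only [Matrix.mul_assoc]
      _ = E * M⁻¹ * Eᵀ := by rw [hTE, hET]
      _ = E * (Cᵀ * Cᵀ⁻¹) * M⁻¹ * (C⁻¹ * C) * Eᵀ := by
        rw [Matrix.mul_nonsing_inv _ hCtdet, Matrix.nonsing_inv_mul _ hCdet, Matrix.mul_one,
          Matrix.mul_one]
      _ = _ := by
        simp only [Matrix.transpose_mul, Matrix.transpose_transpose, Matrix.mul_assoc]

end LinearAlgebra

/-! ### Lyapunov's central limit theorem via characteristic functions -/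

section CentralLimit

/-- The Taylor remainder is of order `|x|³`. The perfect square `x² (θ - |x|)² ≥ 0` trades it for
second and fourth powers with a free parameter `θ`, so third moments never appear. -/
theorem norm_exp_mul_I_sub_taylor_le (x : ℝ) {θ : ℝ} (hθ : 0 < θ) :
    ‖Complex.exp (x * Complex.I) - (1 + x * Complex.I - x ^ 2 / 2)‖ ≤
      2 * θ * x ^ 2 + 2 / θ * x ^ 4 := by
  have hcube : 4 * |x| ^ 3 ≤ 2 * θ * x ^ 2 + 2 / θ * x ^ 4 := by
    have h1 : 2 * θ * x ^ 2 + 2 / θ * x ^ 4 - 4 * |x| ^ 3 = 2 / θ * x ^ 2 * (θ - |x|) ^ 2 := by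
      have hx2 : |x| ^ 2 = x ^ 2 := sq_abs x
      have hx3 : |x| ^ 3 = |x| * x ^ 2 := by rw [← hx2]; ring
      rw [hx3]; field_simp; ring_nf; rw [hx2]; ring
    have h2 : 0 ≤ 2 / θ * x ^ 2 * (θ - |x|) ^ 2 := by positivity
    linarith
  refine le_trans ?_ hcube
  rcases le_total |x| 1 with hx | hx
  · have h := Complex.exp_bound (x := x * Complex.I) (by simpa using hx) (n := 3) (by norm_num)
    have h3 : ∑ m ∈ Finset.range 3, ((x : ℂ) * Complex.I) ^ m / (m.factorial : ℂ) =
        1 + x * Complex.I - x ^ 2 / 2 := by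
      simp [Finset.sum_range_succ, mul_pow, Nat.factorial]; ring
    rw [h3] at h
    refine h.trans ?_
    simp [Nat.factorial]
    nlinarith [pow_nonneg (abs_nonneg x) 3]
  · have h1 : ‖Complex.exp (x * Complex.I)‖ = 1 := Complex.norm_exp_ofReal_mul_I x
    have h2 : ‖(1 : ℂ) + x * Complex.I - x ^ 2 / 2‖ ≤ 1 + |x| + |x| ^ 2 / 2 := by
      refine (norm_sub_le _ _).trans (add_le_add ((norm_add_le _ _).trans ?_) ?_)
      · simp
      · simp
    refine (norm_sub_le _ _).trans ?_
    rw [h1]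
    have h4 : |x| ≤ |x| ^ 3 := le_self_pow₀ hx (by norm_num)
    have h5 : |x| ^ 2 ≤ |x| ^ 3 := pow_le_pow_right₀ hx (by norm_num)
    linarith

theorem abs_exp_neg_sub_le {y : ℝ} (hy : 0 ≤ y) : |Real.exp (-y) - (1 - y)| ≤ y ^ 2 := by
  rcases le_total y 1 with h | h
  · have := Real.abs_exp_sub_one_sub_id_le (x := -y) (by rwa [abs_neg, abs_of_nonneg hy])
    rw [neg_sq] at this
    convert this using 2
    ring
  · have h1 := Real.add_one_le_exp (-y)
    have h2 : Real.exp (-y) ≤ 1 := Real.exp_le_one_iff.mpr (by linarith)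
    rw [abs_le]
    constructor <;> nlinarith

/-- Telescoping: factors are exchanged one at a time, the others having norm at most one. -/
theorem norm_prod_sub_prod_le {ι : Type*} (s : Finset ι) (x y : ι → ℂ)
    (hx : ∀ i, ‖x i‖ ≤ 1) (hy : ∀ i, ‖y i‖ ≤ 1) :
    ‖∏ i ∈ s, x i - ∏ i ∈ s, y i‖ ≤ ∑ i ∈ s, ‖x i - y i‖ := by
  classical
  induction s using Finset.induction_on with
  | empty => simp
  | insert i s hi ih =>
    rw [Finset.prod_insert hi, Finset.prod_insert hi, Finset.sum_insert hi]
    have h1 : ‖∏ j ∈ s, x j‖ ≤ 1 := by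
      rw [norm_prod]; exact Finset.prod_le_one (fun _ _ => norm_nonneg _) fun j _ => hx j
    calc ‖x i * ∏ j ∈ s, x j - y i * ∏ j ∈ s, y j‖
        = ‖(x i - y i) * ∏ j ∈ s, x j + y i * (∏ j ∈ s, x j - ∏ j ∈ s, y j)‖ := by ring_nf
      _ ≤ ‖x i - y i‖ * 1 + 1 * ‖∏ j ∈ s, x j - ∏ j ∈ s, y j‖ := by
        refine (norm_add_le _ _).trans ?_
        rw [norm_mul, norm_mul]
        gcongr
        exact hy i
      _ ≤ _ := by rw [mul_one, one_mul]; gcongr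

variable {Ω : Type*} [MeasurableSpace Ω] {P : Measure Ω} [IsProbabilityMeasure P]

theorem integrable_sq_of_pow_four {X : Ω → ℝ} (hX : Measurable X)
    (h4 : Integrable (fun ω => X ω ^ 4) P) : Integrable (fun ω => X ω ^ 2) P := by
  refine ((integrable_const (1 : ℝ)).add h4).mono' (hX.pow_const 2).aestronglyMeasurable ?_
  filter_upwards with ω
  rw [Real.norm_eq_abs, abs_of_nonneg (sq_nonneg _), Pi.add_apply]
  nlinarith [sq_nonneg (X ω ^ 2 - 1)]

theorem memLp_two_of_pow_four {X : Ω → ℝ} (hX : Measurable X)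
    (h4 : Integrable (fun ω => X ω ^ 4) P) : MemLp X 2 P :=
  (memLp_two_iff_integrable_sq hX.aestronglyMeasurable).mpr (integrable_sq_of_pow_four hX h4)

/-- This is nonnegativity of the variance of `X²`. -/
theorem sq_integral_sq_le {X : Ω → ℝ} (hX : Measurable X)
    (h4 : Integrable (fun ω => X ω ^ 4) P) : (∫ ω, X ω ^ 2 ∂P) ^ 2 ≤ ∫ ω, X ω ^ 4 ∂P := by
  have hL : MemLp (fun ω => X ω ^ 2) 2 P :=
    (memLp_two_iff_integrable_sq (hX.pow_const 2).aestronglyMeasurable).mpr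
      (by simpa [← pow_mul] using h4)
  have h := variance_nonneg (fun ω => X ω ^ 2) P
  rw [variance_eq_sub hL] at h
  have h2 : P[(fun ω => X ω ^ 2) ^ 2] = ∫ ω, X ω ^ 4 ∂P := by simp [← pow_mul]
  rw [h2] at h
  linarith

/-- Both terms are compared with `1 - v / 2`, where `v` is the variance: the first by the Taylor
bound, the second with an error of order `v²`, which the fourth moment dominates. The argument `1`
suffices because scale and direction are absorbed into `X`. -/
theorem norm_charFun_sub_exp_le {X : Ω → ℝ} (hX : Measurable X) (h0 : P[X] = 0)
    (h4 : Integrable (fun ω => X ω ^ 4) P) {θ : ℝ} (hθ : 0 < θ) :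
    ‖charFun (P.map X) 1 - Complex.exp (-(∫ ω, X ω ^ 2 ∂P : ℝ) / 2)‖ ≤
      2 * θ * ∫ ω, X ω ^ 2 ∂P + (2 / θ + 1) * ∫ ω, X ω ^ 4 ∂P := by
  have h2 := integrable_sq_of_pow_four hX h4
  have h1 : Integrable X P := (memLp_two_of_pow_four hX h4).integrable (by norm_num)
  set v := ∫ ω, X ω ^ 2 ∂P with hv
  have hv0 : 0 ≤ v := integral_nonneg fun ω => sq_nonneg _
  have hc : charFun (P.map X) 1 = ∫ ω, Complex.exp (X ω * Complex.I) ∂P := by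
    rw [charFun_apply_real, integral_map hX.aemeasurable]
    · simp
    · exact (by fun_prop : Measurable _).aestronglyMeasurable
  have hiE : Integrable (fun ω => Complex.exp (X ω * Complex.I)) P := by
    refine (integrable_const (1 : ℝ)).mono' (by fun_prop) ?_
    filter_upwards with ω
    rw [Complex.norm_exp_ofReal_mul_I]
  have hiT : Integrable (fun ω => ((1 : ℂ) + X ω * Complex.I - (X ω : ℂ) ^ 2 / 2)) P := by
    have h2c : Integrable (fun ω => ((X ω : ℂ)) ^ 2) P := by
      simpa using h2.ofReal (𝕜 := ℂ)
    exact ((integrable_const _).add (h1.ofReal.mul_const _)).sub (h2c.div_const _)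
  have hT : (∫ ω, ((1 : ℂ) + X ω * Complex.I - (X ω : ℂ) ^ 2 / 2) ∂P) = (1 : ℂ) - (v : ℂ) / 2 := by
    have h2c : Integrable (fun ω => ((X ω : ℂ)) ^ 2) P := by
      simpa using h2.ofReal (𝕜 := ℂ)
    rw [integral_sub, integral_add, integral_mul_const, integral_div, integral_complex_ofReal, h0]
    · have : ∫ ω, (X ω : ℂ) ^ 2 ∂P = (v : ℂ) := by
        rw [hv, ← integral_complex_ofReal]; simp
      simp [this]
    · exact integrable_const _
    · exact h1.ofReal.mul_const _
    · exact (integrable_const _).add (h1.ofReal.mul_const _)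
    · exact h2c.div_const _
  have hA : ‖charFun (P.map X) 1 - ((1 : ℂ) - (v : ℂ) / 2)‖ ≤
      2 * θ * v + 2 / θ * ∫ ω, X ω ^ 4 ∂P := by
    rw [hc, ← hT, ← integral_sub hiE hiT, hv, ← integral_const_mul, ← integral_const_mul,
      ← integral_add (h2.const_mul _) (h4.const_mul _)]
    exact norm_integral_le_of_norm_le ((h2.const_mul _).add (h4.const_mul _))
      (Eventually.of_forall fun ω => norm_exp_mul_I_sub_taylor_le (X ω) hθ)
  have hB : ‖((1 : ℂ) - v / 2) - Complex.exp (-(v : ℝ) / 2)‖ ≤ ∫ ω, X ω ^ 4 ∂P := by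
    have h := abs_exp_neg_sub_le (y := v / 2) (by positivity)
    have h5 := sq_integral_sq_le hX h4
    have h6 : ((1 : ℂ) - v / 2) - Complex.exp (-(v : ℝ) / 2) =
        ((-(Real.exp (-(v / 2)) - (1 - v / 2)) : ℝ) : ℂ) := by
      push_cast; ring_nf
    rw [h6, Complex.norm_real, Real.norm_eq_abs, abs_neg]
    refine h.trans ?_
    rw [div_pow]
    nlinarith [sq_nonneg v]
  calc _ = ‖(charFun (P.map X) 1 - ((1 : ℂ) - v / 2)) +
        (((1 : ℂ) - v / 2) - Complex.exp (-(v : ℝ) / 2))‖ := by ring_nf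
    _ ≤ _ := (norm_add_le _ _).trans (add_le_add hA hB)
    _ = _ := by ring

theorem norm_charFun_sum_sub_exp_le {S : Type*} [Fintype S] {ξ : S → Ω → ℝ}
    (hξ : ∀ s, Measurable (ξ s)) (hind : iIndepFun ξ P) (h0 : ∀ s, P[ξ s] = 0)
    (h4 : ∀ s, Integrable (fun ω => ξ s ω ^ 4) P) {η : ℝ} (hη : 0 < η)
    (hη4 : ∑ s, ∫ ω, ξ s ω ^ 4 ∂P ≤ η) :
    ‖charFun (P.map fun ω => ∑ s, ξ s ω) 1 -
        Complex.exp (-(∑ s, ∫ ω, ξ s ω ^ 2 ∂P : ℝ) / 2)‖ ≤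
      2 * √η * ∑ s, ∫ ω, ξ s ω ^ 2 ∂P + 2 * √η + η := by
  have hs : 0 < √η := Real.sqrt_pos.mpr hη
  rw [hind.charFun_map_fun_sum_eq_prod fun s => (hξ s).aemeasurable, Finset.prod_apply]
  have hexp : Complex.exp (-(∑ s, ∫ ω, ξ s ω ^ 2 ∂P : ℝ) / 2) =
      ∏ s, Complex.exp (-(∫ ω, ξ s ω ^ 2 ∂P : ℝ) / 2) := by
    rw [← Complex.exp_sum, Complex.ofReal_sum, ← Finset.sum_neg_distrib, Finset.sum_div]
  rw [hexp]
  refine (norm_prod_sub_prod_le _ _ _ (fun s => ?_) fun s => ?_).trans ?_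
  · have := Measure.isProbabilityMeasure_map (μ := P) (hξ s).aemeasurable
    exact norm_charFun_le_one _
  · rw [Complex.norm_exp]
    have h2 : 0 ≤ ∫ ω, ξ s ω ^ 2 ∂P := integral_nonneg fun ω => sq_nonneg _
    have : (-((∫ ω, ξ s ω ^ 2 ∂P : ℝ) : ℂ) / 2).re = -(∫ ω, ξ s ω ^ 2 ∂P) / 2 := by
      rw [← Complex.ofReal_neg, Complex.div_ofNat_re, Complex.ofReal_re]
    rw [this]
    exact Real.exp_le_one_iff.mpr (by linarith)
  · calc _ ≤ ∑ s, (2 * √η * ∫ ω, ξ s ω ^ 2 ∂P + (2 / √η + 1) * ∫ ω, ξ s ω ^ 4 ∂P) :=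
          Finset.sum_le_sum fun s _ => norm_charFun_sub_exp_le (hξ s) (h0 s) (h4 s) hs
      _ = 2 * √η * ∑ s, ∫ ω, ξ s ω ^ 2 ∂P + (2 / √η + 1) * ∑ s, ∫ ω, ξ s ω ^ 4 ∂P := by
        rw [Finset.sum_add_distrib, ← Finset.mul_sum, ← Finset.mul_sum]
      _ ≤ 2 * √η * ∑ s, ∫ ω, ξ s ω ^ 2 ∂P + (2 / √η + 1) * η := by gcongr
      _ = _ := by
        have : 2 / √η * η = 2 * √η := by
          rw [div_mul_eq_mul_div, div_eq_iff hs.ne', mul_assoc, Real.mul_self_sqrt hη.le]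
        rw [add_mul, this]; ring

/-- Lyapunov's central limit theorem for triangular arrays, in terms of characteristic
functions. -/
theorem tendsto_charFun_sum {S : ℕ → Type*} [∀ N, Fintype (S N)] {ξ : ∀ N, S N → Ω → ℝ}
    (hξ : ∀ N s, Measurable (ξ N s)) (hind : ∀ N, iIndepFun (ξ N) P)
    (h0 : ∀ N s, P[ξ N s] = 0) (h4 : ∀ N s, Integrable (fun ω => ξ N s ω ^ 4) P) {v : ℝ}
    (hvar : Tendsto (fun N => ∑ s, ∫ ω, ξ N s ω ^ 2 ∂P) atTop (𝓝 v))
    (hlyap : Tendsto (fun N => ∑ s, ∫ ω, ξ N s ω ^ 4 ∂P) atTop (𝓝 0)) :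
    Tendsto (fun N => charFun (P.map fun ω => ∑ s, ξ N s ω) 1) atTop
      (𝓝 (Complex.exp (-(v : ℂ) / 2))) := by
  -- The summand `1 / (N + 1)` keeps `η` strictly positive even when the fourth moments vanish,
  -- since `√η` serves as the parameter `θ`, which has to be positive.
  have hη : Tendsto (fun N : ℕ => ∑ s, ∫ ω, ξ N s ω ^ 4 ∂P + 1 / ((N : ℝ) + 1)) atTop (𝓝 0) := by
    simpa using hlyap.add (tendsto_one_div_add_atTop_nhds_zero_nat (𝕜 := ℝ))
  have hpos : ∀ N : ℕ, 0 < ∑ s, ∫ ω, ξ N s ω ^ 4 ∂P + 1 / ((N : ℝ) + 1) := fun N =>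
    add_pos_of_nonneg_of_pos (Finset.sum_nonneg fun s _ => integral_nonneg fun ω => by positivity)
      (by positivity)
  have hsq := hη.sqrt
  rw [Real.sqrt_zero] at hsq
  have hbound := ((hsq.const_mul 2).mul hvar |>.add (hsq.const_mul 2)).add hη
  simp only [mul_zero, zero_mul, add_zero] at hbound
  have hdiff := squeeze_zero_norm (fun N => norm_charFun_sum_sub_exp_le (hξ N) (hind N) (h0 N)
    (h4 N) (hpos N) (le_add_of_nonneg_right (by positivity))) hbound
  have hexp : Tendsto (fun N => Complex.exp (-(∑ s, ∫ ω, ξ N s ω ^ 2 ∂P : ℝ) / 2)) atTop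
      (𝓝 (Complex.exp (-(v : ℂ) / 2))) :=
    (Complex.continuous_exp.tendsto _).comp
      (((Complex.continuous_ofReal.tendsto v).comp hvar).neg.div_const 2)
  simpa using hdiff.add hexp

end CentralLimit

/-! ### Law of large numbers for weighted products of residuals -/

section WeightedResiduals

variable {Ω : Type*} [MeasurableSpace Ω] {P : Measure Ω} [IsProbabilityMeasure P]
  {S : Type*} [Fintype S]

theorem integral_sq_sum_eq {X : S → Ω → ℝ} (hX : ∀ s, MemLp (X s) 2 P) (hind : iIndepFun X P)
    (h0 : ∀ s, P[X s] = 0) : ∫ ω, (∑ s, X s ω) ^ 2 ∂P = ∑ s, ∫ ω, X s ω ^ 2 ∂P := by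
  have h := IndepFun.variance_sum (s := Finset.univ) (fun s _ => hX s)
    (fun s _ t _ hst => hind.indepFun hst)
  have hm : AEMeasurable (∑ s, X s) P :=
    Finset.aemeasurable_sum _ fun s _ => (hX s).aestronglyMeasurable.aemeasurable
  have hz : P[∑ s, X s] = 0 := by
    simp only [Finset.sum_apply]
    rw [integral_finsetSum _ fun s _ => (hX s).integrable (by norm_num)]
    exact Finset.sum_eq_zero fun s _ => h0 s
  rw [variance_of_integral_eq_zero hm hz] at h
  simp only [Finset.sum_apply] at h
  rw [h]
  exact Finset.sum_congr rfl fun s _ =>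
    variance_of_integral_eq_zero (hX s).aestronglyMeasurable.aemeasurable (h0 s)

/-- Integrate `2|u| ≤ u² / θ + θ` and use additivity of the variance for independent centered terms.
-/
theorem integral_abs_sum_le {X : S → Ω → ℝ} (hX : ∀ s, MemLp (X s) 2 P) (hind : iIndepFun X P)
    (h0 : ∀ s, P[X s] = 0) {θ : ℝ} (hθ : 0 < θ) :
    ∫ ω, |∑ s, X s ω| ∂P ≤ ((∑ s, ∫ ω, X s ω ^ 2 ∂P) / θ + θ) / 2 := by
  have hL : MemLp (fun ω => ∑ s, X s ω) 2 P := memLp_finsetSum _ fun s _ => hX s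
  rw [← integral_sq_sum_eq hX hind h0, ← integral_div]
  have hc : (θ : ℝ) = ∫ _ : Ω, θ ∂P := by simp
  conv_rhs => rw [hc]
  have hi := hL.integrable_sq
  rw [← integral_add (by simpa using hi.div_const _) (integrable_const _), ← integral_div]
  refine integral_mono (hL.integrable (by norm_num)).abs ?_ fun ω => ?_
  · simpa using ((hi.div_const θ).add (integrable_const θ)).div_const 2
  · have : (∑ s, X s ω) ^ 2 / θ + θ - 2 * |∑ s, X s ω| = (|∑ s, X s ω| - θ) ^ 2 / θ := by
      rw [← sq_abs]; field_simp; ring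
    have h2 : 0 ≤ (|∑ s, X s ω| - θ) ^ 2 / θ := by positivity
    simp only [← hc]
    linarith

theorem integral_sq_linear_le {x : S → Ω → ℝ} (hx : ∀ s, MemLp (x s) 2 P)
    (hind : iIndepFun x P) (h0 : ∀ s, P[x s] = 0) {K η : ℝ} (hK : 0 ≤ K)
    (h2 : ∀ s, ∫ ω, x s ω ^ 2 ∂P ≤ K) {v : S → ℝ} (hv : ∑ t, v t ^ 2 ≤ η) :
    ∫ ω, (∑ t, v t * x t ω) ^ 2 ∂P ≤ K * η := by
  have hind' : iIndepFun (fun t ω => v t * x t ω) P :=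
    hind.comp (fun t u => v t * u) fun t => measurable_const_mul _
  rw [integral_sq_sum_eq (fun t => (hx t).const_mul _) hind' fun t => by
    rw [integral_const_mul, h0, mul_zero]]
  calc ∑ t, ∫ ω, (v t * x t ω) ^ 2 ∂P = ∑ t, v t ^ 2 * ∫ ω, x t ω ^ 2 ∂P := by
        simp only [mul_pow, integral_const_mul]
    _ ≤ ∑ t, v t ^ 2 * K := Finset.sum_le_sum fun t _ =>
        mul_le_mul_of_nonneg_left (h2 t) (sq_nonneg _)
    _ ≤ K * η := by rw [← Finset.sum_mul, mul_comm]; gcongr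

/-- The difference is `-s x - r y + r s`. In the cross terms the corrections `r`, `s` are small but
`x`, `y` are not, so Young's inequality is weighted by `θ`. -/
theorem abs_residual_mul_sub_le (x y r s : ℝ) {θ : ℝ} (hθ : 0 < θ) :
    |(x - r) * (y - s) - x * y| ≤
      (r ^ 2 + s ^ 2) / (2 * θ) + θ * (x ^ 2 + y ^ 2) / 2 + (r ^ 2 + s ^ 2) / 2 := by
  have am : ∀ u v : ℝ, |u * v| ≤ u ^ 2 / (2 * θ) + θ * v ^ 2 / 2 := fun u v => by
    have h1 : u ^ 2 / (2 * θ) + θ * v ^ 2 / 2 - |u| * |v| = (|u| - θ * |v|) ^ 2 / (2 * θ) := by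
      rw [← sq_abs u, ← sq_abs v]; field_simp; ring
    have h2 : 0 ≤ (|u| - θ * |v|) ^ 2 / (2 * θ) := by positivity
    rw [abs_mul]; linarith
  have h3 : |r * s| ≤ (r ^ 2 + s ^ 2) / 2 := by
    rw [abs_mul, ← sq_abs r, ← sq_abs s]; nlinarith [sq_nonneg (|r| - |s|)]
  calc |(x - r) * (y - s) - x * y| = |-(s * x) - r * y + r * s| := by ring_nf
    _ ≤ |s * x| + |r * y| + |r * s| := by
      refine (abs_add_le _ _).trans ?_
      gcongr
      refine (abs_sub _ _).trans ?_
      rw [abs_neg]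
    _ ≤ _ := by
      have e1 := am s x
      have e2 := am r y
      have e3 : (r ^ 2 + s ^ 2) / (2 * θ) = r ^ 2 / (2 * θ) + s ^ 2 / (2 * θ) := add_div _ _ _
      linarith

/-- Weighted sums of products of the residuals `x - h x`, `y - h y` are close in mean to the
corresponding weighted sums of covariances, when weights and leverages are small. -/
theorem integral_abs_weighted_residual_le {x y : S → Ω → ℝ} (hx : ∀ s, Measurable (x s))
    (hy : ∀ s, Measurable (y s)) (hind : iIndepFun (fun s ω => (x s ω, y s ω)) P)
    (hx0 : ∀ s, P[x s] = 0) (hy0 : ∀ s, P[y s] = 0)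
    (hx4 : ∀ s, Integrable (fun ω => x s ω ^ 4) P) (hy4 : ∀ s, Integrable (fun ω => y s ω ^ 4) P)
    {K : ℝ} (hxK2 : ∀ s, ∫ ω, x s ω ^ 2 ∂P ≤ K) (hyK2 : ∀ s, ∫ ω, y s ω ^ 2 ∂P ≤ K)
    (hxK4 : ∀ s, ∫ ω, x s ω ^ 4 ∂P ≤ K) (hyK4 : ∀ s, ∫ ω, y s ω ^ 4 ∂P ≤ K) (hK : 0 ≤ K)
    {w : S → ℝ} {h : S → S → ℝ} {C η : ℝ} (hη : 0 < η) (hw : ∀ s, |w s| ≤ η)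
    (hwC : ∑ s, |w s| ≤ C) (hh : ∀ s, ∑ t, h s t ^ 2 ≤ η) :
    ∫ ω, |∑ s, w s * ((x s ω - ∑ t, h s t * x t ω) * (y s ω - ∑ t, h s t * y t ω)) -
        ∑ s, w s * ∫ ω, x s ω * y s ω ∂P| ∂P ≤
      √η * (C * K + 1) / 2 + C * (2 * K * √η + K * η) := by
  have hs : 0 < √η := Real.sqrt_pos.mpr hη
  have hsq : √η * √η = η := Real.mul_self_sqrt hη.le
  have hxL : ∀ s, MemLp (x s) 2 P := fun s => memLp_two_of_pow_four (hx s) (hx4 s)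
  have hyL : ∀ s, MemLp (y s) 2 P := fun s => memLp_two_of_pow_four (hy s) (hy4 s)
  have hxi : iIndepFun x P := hind.comp (fun _ z => z.1) fun _ => measurable_fst
  have hyi : iIndepFun y P := hind.comp (fun _ z => z.2) fun _ => measurable_snd
  have hxy2 : ∀ s, Integrable (fun ω => (x s ω * y s ω) ^ 2) P := fun s => by
    refine ((hx4 s).add (hy4 s)).mono' (((hx s).mul (hy s)).pow_const 2).aestronglyMeasurable ?_
    filter_upwards with ω
    rw [Real.norm_eq_abs, abs_of_nonneg (sq_nonneg _), Pi.add_apply]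
    nlinarith [sq_nonneg (x s ω ^ 2 - y s ω ^ 2), sq_nonneg (x s ω ^ 2), sq_nonneg (y s ω ^ 2)]
  have hxyL : ∀ s, MemLp (fun ω => x s ω * y s ω) 2 P := fun s =>
    (memLp_two_iff_integrable_sq ((hx s).mul (hy s)).aestronglyMeasurable).mpr (hxy2 s)
  have hxyK : ∀ s, ∫ ω, (x s ω * y s ω) ^ 2 ∂P ≤ K := fun s => by
    have h1 : ∫ ω, (x s ω * y s ω) ^ 2 ∂P ≤ ∫ ω, (x s ω ^ 4 + y s ω ^ 4) / 2 ∂P := by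
      refine integral_mono (hxy2 s) (((hx4 s).add (hy4 s)).div_const 2) fun ω => ?_
      simp only
      nlinarith [sq_nonneg (x s ω ^ 2 - y s ω ^ 2)]
    rw [integral_div, integral_add (hx4 s) (hy4 s)] at h1
    linarith [hxK4 s, hyK4 s]
  -- `X` is the fluctuation of the error products about their means. Its variance is small because
  -- the squared weights satisfy `w² ≤ η |w|` and the total weight is bounded.
  let X : S → Ω → ℝ := fun s ω => w s * (x s ω * y s ω - ∫ ω, x s ω * y s ω ∂P)
  have hXL : ∀ s, MemLp (X s) 2 P := fun s =>
    ((hxyL s).sub (memLp_const (∫ ω, x s ω * y s ω ∂P))).const_mul (w s)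
  have hXi : iIndepFun X P :=
    hind.comp (fun s z => w s * (z.1 * z.2 - ∫ ω, x s ω * y s ω ∂P)) fun s => by fun_prop
  have hX0 : ∀ s, P[X s] = 0 := fun s => by
    simp only [X]
    rw [integral_const_mul, integral_sub ((hxyL s).integrable (by norm_num)) (integrable_const _)]
    simp
  have hXsq : ∀ s, ∫ ω, X s ω ^ 2 ∂P ≤ η * |w s| * K := fun s => by
    have h1 : ∫ ω, (x s ω * y s ω - ∫ ω, x s ω * y s ω ∂P) ^ 2 ∂P ≤ K := by
      have := variance_le_expectation_sq (μ := P) ((hxyL s).aestronglyMeasurable)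
      rw [variance_eq_integral ((hxyL s).aestronglyMeasurable.aemeasurable)] at this
      exact this.trans (hxyK s)
    simp only [X, mul_pow, integral_const_mul]
    have h2 : w s ^ 2 ≤ η * |w s| := by
      rw [← sq_abs, sq]; exact mul_le_mul_of_nonneg_right (hw s) (abs_nonneg _)
    exact mul_le_mul h2 h1 (integral_nonneg fun _ => sq_nonneg _) (by positivity)
  have hpart1 : ∫ ω, |∑ s, X s ω| ∂P ≤ √η * (C * K + 1) / 2 := by
    refine (integral_abs_sum_le hXL hXi hX0 hs).trans ?_
    have h1 : ∑ s, ∫ ω, X s ω ^ 2 ∂P ≤ η * C * K := by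
      calc _ ≤ ∑ s, η * |w s| * K := Finset.sum_le_sum fun s _ => hXsq s
        _ = η * (∑ s, |w s|) * K := by rw [← Finset.sum_mul, ← Finset.mul_sum]
        _ ≤ _ := by gcongr
    have h2 : (∑ s, ∫ ω, X s ω ^ 2 ∂P) / √η ≤ √η * (C * K) := by
      rw [div_le_iff₀ hs]
      calc _ ≤ η * C * K := h1
        _ = √η * √η * (C * K) := by rw [hsq]; ring
        _ = _ := by ring
    linarith
  let r : S → Ω → ℝ := fun s ω => ∑ t, h s t * x t ω
  let q : S → Ω → ℝ := fun s ω => ∑ t, h s t * y t ω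
  have hrL : ∀ s, MemLp (r s) 2 P := fun s => memLp_finsetSum _ fun t _ => (hxL t).const_mul _
  have hqL : ∀ s, MemLp (q s) 2 P := fun s => memLp_finsetSum _ fun t _ => (hyL t).const_mul _
  have hrK : ∀ s, ∫ ω, r s ω ^ 2 ∂P ≤ K * η := fun s =>
    integral_sq_linear_le hxL hxi hx0 hK hxK2 (hh s)
  have hqK : ∀ s, ∫ ω, q s ω ^ 2 ∂P ≤ K * η := fun s =>
    integral_sq_linear_le hyL hyi hy0 hK hyK2 (hh s)
  -- `D` is the effect of using residuals in place of errors. The corrections `r`, `q` have second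
  -- moment at most `K η`, by the leverage bound, so `θ = √η` balances the cross terms.
  let D : S → Ω → ℝ := fun s ω => (x s ω - r s ω) * (y s ω - q s ω) - x s ω * y s ω
  have hDint : ∀ s, Integrable (D s) P := fun s =>
    (((hxL s).sub (hrL s)).integrable_mul ((hyL s).sub (hqL s))).sub
      ((hxL s).integrable_mul (hyL s))
  have hDK : ∀ s, ∫ ω, |D s ω| ∂P ≤ 2 * K * √η + K * η := fun s => by
    have ir := (hrL s).integrable_sq
    have iq := (hqL s).integrable_sq
    have ix := (hxL s).integrable_sq
    have iy := (hyL s).integrable_sq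
    have i1 : Integrable (fun ω => (r s ω ^ 2 + q s ω ^ 2) / (2 * √η)) P :=
      (ir.add iq).div_const _
    have i2 : Integrable (fun ω => √η * (x s ω ^ 2 + y s ω ^ 2) / 2) P :=
      ((ix.add iy).const_mul _).div_const _
    have i3 : Integrable (fun ω => (r s ω ^ 2 + q s ω ^ 2) / 2) P := (ir.add iq).div_const _
    have i12 : Integrable (fun ω => (r s ω ^ 2 + q s ω ^ 2) / (2 * √η) +
        √η * (x s ω ^ 2 + y s ω ^ 2) / 2) P := i1.add i2
    calc ∫ ω, |D s ω| ∂P ≤ ∫ ω, ((r s ω ^ 2 + q s ω ^ 2) / (2 * √η) +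
          √η * (x s ω ^ 2 + y s ω ^ 2) / 2 + (r s ω ^ 2 + q s ω ^ 2) / 2) ∂P :=
          integral_mono (hDint s).abs (i12.add i3) fun ω =>
            abs_residual_mul_sub_le _ _ _ _ hs
      _ = (∫ ω, r s ω ^ 2 ∂P + ∫ ω, q s ω ^ 2 ∂P) / (2 * √η) +
          √η * (∫ ω, x s ω ^ 2 ∂P + ∫ ω, y s ω ^ 2 ∂P) / 2 +
          (∫ ω, r s ω ^ 2 ∂P + ∫ ω, q s ω ^ 2 ∂P) / 2 := by
        rw [integral_add i12 i3, integral_add i1 i2, integral_div, integral_div,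
          integral_div, integral_const_mul, integral_add ir iq, integral_add ix iy]
      _ ≤ (K * η + K * η) / (2 * √η) + √η * (K + K) / 2 + (K * η + K * η) / 2 := by
        gcongr
        exacts [hrK s, hqK s, hxK2 s, hyK2 s, hrK s, hqK s]
      _ = _ := by
        have : (K * η + K * η) / (2 * √η) = K * √η := by
          rw [div_eq_iff (by positivity)]
          calc K * η + K * η = 2 * K * (√η * √η) := by rw [hsq]; ring
            _ = _ := by ring
        rw [this]; ring
  have hsplit : ∀ ω, ∑ s, w s * ((x s ω - r s ω) * (y s ω - q s ω)) -
      ∑ s, w s * ∫ ω, x s ω * y s ω ∂P = ∑ s, X s ω + ∑ s, w s * D s ω := fun ω => by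
    rw [← Finset.sum_sub_distrib, ← Finset.sum_add_distrib]
    exact Finset.sum_congr rfl fun s _ => by simp only [X, D]; ring
  have iX : Integrable (fun ω => ∑ s, X s ω) P :=
    integrable_finsetSum _ fun s _ => (hXL s).integrable (by norm_num)
  have iD : Integrable (fun ω => ∑ s, |w s| * |D s ω|) P :=
    integrable_finsetSum _ fun s _ => (hDint s).abs.const_mul _
  have iD' : Integrable (fun ω => ∑ s, w s * D s ω) P :=
    integrable_finsetSum _ fun s _ => (hDint s).const_mul _
  calc _ = ∫ ω, |∑ s, X s ω + ∑ s, w s * D s ω| ∂P := integral_congr_ae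
        (Eventually.of_forall fun ω => congrArg abs (hsplit ω))
    _ ≤ ∫ ω, (|∑ s, X s ω| + ∑ s, |w s| * |D s ω|) ∂P := by
      refine integral_mono (iX.add iD').abs (iX.abs.add iD) fun ω => ?_
      refine (abs_add_le _ _).trans (add_le_add le_rfl ((Finset.abs_sum_le_sum_abs _ _).trans ?_))
      exact Finset.sum_le_sum fun s _ => (abs_mul _ _).le
    _ = ∫ ω, |∑ s, X s ω| ∂P + ∑ s, |w s| * ∫ ω, |D s ω| ∂P := by
      rw [integral_add iX.abs iD, integral_finsetSum _ fun s _ => (hDint s).abs.const_mul _]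
      simp only [integral_const_mul]
    _ ≤ √η * (C * K + 1) / 2 + ∑ s, |w s| * (2 * K * √η + K * η) := by
      gcongr with s
      exact hDK s
    _ ≤ _ := by
      rw [← Finset.sum_mul]
      gcongr

end WeightedResiduals

/-! ### Exact identities for least squares and the White estimator -/

section DesignAlgebra

variable {a c : ℕ}

/-- The row of the design matrix belonging to subject `j` of group `i`. -/
def designRow (z : Fin a → ℕ → Fin c → ℝ) (i : Fin a) (j : ℕ) : Fin a ⊕ Fin c → ℝ :=
  Sum.elim (fun i' => if i = i' then 1 else 0) (z i j)

/-- The contribution of group `i` to the Gram matrix of the design. -/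
def groupGram (n : Fin a → ℕ) (z : Fin a → ℕ → Fin c → ℝ) (i : Fin a) :
    Matrix (Fin a ⊕ Fin c) (Fin a ⊕ Fin c) ℝ :=
  Matrix.of fun b b' => ∑ j ∈ Finset.range (n i), designRow z i j b * designRow z i j b'

/-- The matrix `(X'X)⁻¹ X'` of the least squares coefficients. -/
def lsCoef (n : Fin a → ℕ) (z : Fin a → ℕ → Fin c → ℝ) :
    Matrix (Fin a ⊕ Fin c) (Subject n) ℝ :=
  ((design n z)ᵀ * design n z)⁻¹ * (design n z)ᵀ

theorem design_apply (n : Fin a → ℕ) (z : Fin a → ℕ → Fin c → ℝ) (s : Subject n)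
    (b : Fin a ⊕ Fin c) : design n z s b = designRow z s.1 s.2 b := by
  cases b <;> simp [design, designRow]

theorem sum_subject (n : Fin a → ℕ) (f : Fin a → ℕ → ℝ) :
    ∑ s : Subject n, f s.1 s.2 = ∑ i, ∑ j ∈ Finset.range (n i), f i j := by
  rw [Fintype.sum_sigma]
  exact Finset.sum_congr rfl fun i _ => (Finset.sum_range (f i)).symm

theorem gram_eq_sum_groupGram (n : Fin a → ℕ) (z : Fin a → ℕ → Fin c → ℝ) :
    (design n z)ᵀ * design n z = ∑ i, groupGram n z i := by
  ext b b'
  simp only [Matrix.mul_apply, Matrix.transpose_apply, design_apply, Matrix.sum_apply, groupGram,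
    Matrix.of_apply]
  exact sum_subject n fun i j => designRow z i j b * designRow z i j b'

theorem gram_inv_transpose (n : Fin a → ℕ) (z : Fin a → ℕ → Fin c → ℝ) :
    (((design n z)ᵀ * design n z)⁻¹)ᵀ = ((design n z)ᵀ * design n z)⁻¹ := by
  rw [Matrix.transpose_nonsing_inv, Matrix.transpose_mul, Matrix.transpose_transpose]

theorem lsCoef_transpose (n : Fin a → ℕ) (z : Fin a → ℕ → Fin c → ℝ) :
    (lsCoef n z)ᵀ = design n z * ((design n z)ᵀ * design n z)⁻¹ := by
  rw [lsCoef, Matrix.transpose_mul, Matrix.transpose_transpose, gram_inv_transpose]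

theorem lsCoef_mul_design {n : Fin a → ℕ} {z : Fin a → ℕ → Fin c → ℝ}
    (h : IsUnit ((design n z)ᵀ * design n z).det) : lsCoef n z * design n z = 1 := by
  rw [lsCoef, Matrix.mul_assoc, Matrix.nonsing_inv_mul _ h]

theorem lsCoef_mul_transpose {n : Fin a → ℕ} {z : Fin a → ℕ → Fin c → ℝ}
    (h : IsUnit ((design n z)ᵀ * design n z).det) :
    lsCoef n z * (lsCoef n z)ᵀ = ((design n z)ᵀ * design n z)⁻¹ := by
  rw [lsCoef_transpose, ← Matrix.mul_assoc, lsCoef_mul_design h, Matrix.one_mul]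

/-- The hat matrix `X (X'X)⁻¹ X'` is symmetric and idempotent, so the squared norm of a row is the
diagonal entry. -/
theorem sum_leverage_sq {n : Fin a → ℕ} {z : Fin a → ℕ → Fin c → ℝ}
    (h : IsUnit ((design n z)ᵀ * design n z).det) (s : Subject n) :
    ∑ t, (design n z * lsCoef n z) s t ^ 2 = ∑ b, design n z s b * lsCoef n z b s := by
  have h1 : (design n z * lsCoef n z) * (design n z * lsCoef n z)ᵀ = design n z * lsCoef n z := by
    rw [Matrix.transpose_mul, Matrix.mul_assoc, ← Matrix.mul_assoc (lsCoef n z),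
      lsCoef_mul_transpose h, lsCoef]
  have h2 := congrFun (congrFun h1 s) s
  rw [Matrix.mul_apply, Matrix.mul_apply] at h2
  rw [← h2]
  exact Finset.sum_congr rfl fun t _ => by rw [Matrix.transpose_apply, sq]

/-- Since `v` depends only on the group, the sandwich splits into one Gram matrix per group, which
is the object whose limit is known. -/
theorem sum_lsCoef_group (n : Fin a → ℕ) (z : Fin a → ℕ → Fin c → ℝ) (v : Fin a → ℝ)
    (b b' : Fin a ⊕ Fin c) :
    ∑ s : Subject n, lsCoef n z b s * lsCoef n z b' s * v s.1 =
      ∑ i, v i * (((design n z)ᵀ * design n z)⁻¹ * groupGram n z i *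
        ((design n z)ᵀ * design n z)⁻¹) b b' := by
  set D := ((design n z)ᵀ * design n z)⁻¹ with hD
  have hDt : ∀ e e', D e e' = D e' e := fun e e' => by
    rw [← Matrix.transpose_apply D, hD, gram_inv_transpose]
  have hc : ∀ (e : Fin a ⊕ Fin c) (s : Subject n),
      lsCoef n z e s = ∑ e', D e e' * designRow z s.1 s.2 e' := fun e s => by
    simp [lsCoef, Matrix.mul_apply, ← hD, design_apply]
  simp only [hc]
  rw [sum_subject n fun i j => (∑ e, D b e * designRow z i j e) *
    (∑ e, D b' e * designRow z i j e) * v i]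
  refine Finset.sum_congr rfl fun i _ => ?_
  rw [← Finset.sum_mul, mul_comm]
  congr 1
  simp only [Matrix.mul_apply, groupGram, Matrix.of_apply, Finset.mul_sum, Finset.sum_mul]
  rw [Finset.sum_comm]
  refine Finset.sum_congr rfl fun e' _ => ?_
  rw [Finset.sum_comm]
  refine Finset.sum_congr rfl fun e _ => Finset.sum_congr rfl fun j _ => ?_
  rw [hDt e' b']
  ring

variable {p : ℕ}

/-- The Kronecker product with the identity passes through products and inverses, so the
multivariate problem is the univariate one in every component. -/
theorem fullDesign_inv_mul (n : Fin a → ℕ) (z : Fin a → ℕ → Fin c → ℝ) :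
    ((fullDesign p n z)ᵀ * fullDesign p n z)⁻¹ * (fullDesign p n z)ᵀ =
      lsCoef n z ⊗ₖ (1 : Matrix (Fin p) (Fin p) ℝ) := by
  rw [fullDesign, ← Matrix.kroneckerMap_transpose, Matrix.transpose_one,
    ← Matrix.mul_kronecker_mul, Matrix.mul_one, Matrix.inv_kronecker, inv_one,
    ← Matrix.mul_kronecker_mul, Matrix.mul_one, lsCoef]

theorem ols_apply (n : Fin a → ℕ) (z : Fin a → ℕ → Fin c → ℝ) (y : Fin a → ℕ → Fin p → ℝ)
    (b : Fin a ⊕ Fin c) (k : Fin p) :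
    ols n z y (b, k) = ∑ s, lsCoef n z b s * y s.1 s.2 k := by
  simp only [ols, fullDesign_inv_mul, Matrix.mulVec, dotProduct, Matrix.kroneckerMap_apply,
    Fintype.sum_prod_type, Matrix.one_apply]
  simp

theorem residual_eq_sub_sum (n : Fin a → ℕ) (z : Fin a → ℕ → Fin c → ℝ)
    (y : Fin a → ℕ → Fin p → ℝ) (s : Subject n) (k : Fin p) :
    residual n z y s k = y s.1 s.2 k - ∑ b, design n z s b * ols n z y (b, k) := by
  simp [residual, muHat, nuHat, Fintype.sum_sum_type, design, sub_sub]

theorem sigmaHat_apply (n : Fin a → ℕ) (z : Fin a → ℕ → Fin c → ℝ) (y : Fin a → ℕ → Fin p → ℝ)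
    (i i' : Fin a) (k l : Fin p) :
    sigmaHat n z y (i, k) (i', l) = ∑ s, lsCoef n z (Sum.inl i) s * lsCoef n z (Sum.inl i') s *
      (residual n z y s k * residual n z y s l) := by
  have h : fullDesign p n z * ((fullDesign p n z)ᵀ * fullDesign p n z)⁻¹ =
      (lsCoef n z)ᵀ ⊗ₖ (1 : Matrix (Fin p) (Fin p) ℝ) := by
    have := congrArg Matrix.transpose (fullDesign_inv_mul (p := p) n z)
    rw [Matrix.transpose_mul, Matrix.transpose_transpose, Matrix.transpose_nonsing_inv,
      Matrix.transpose_mul, Matrix.transpose_transpose, ← Matrix.kroneckerMap_transpose,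
      Matrix.transpose_one] at this
    exact this
  rw [sigmaHat, Matrix.submatrix_apply, whiteFull, Matrix.mul_assoc _ (fullDesign p n z), h,
    fullDesign_inv_mul]
  simp only [Matrix.mul_apply, Matrix.kroneckerMap_apply, Matrix.one_apply, SHat, Matrix.of_apply,
    Fintype.sum_prod_type, Matrix.transpose_apply]
  simp only [mul_ite, mul_one, mul_zero, ite_mul, zero_mul, Finset.sum_ite_irrel,
    Finset.sum_ite_eq, Finset.mem_univ, if_true, Finset.sum_ite_eq', Finset.sum_const_zero]
  exact Finset.sum_congr rfl fun s _ => by ring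

section Model

variable {n : Fin a → ℕ} {z : Fin a → ℕ → Fin c → ℝ} {μ : Fin a × Fin p → ℝ}
  {ν : Fin c × Fin p → ℝ} {e y : Fin a → ℕ → Fin p → ℝ}

theorem ols_eq_add (hy : ∀ i j k, y i j k = μ (i, k) + ∑ w, z i j w * ν (w, k) + e i j k)
    (h : IsUnit ((design n z)ᵀ * design n z).det) (b : Fin a ⊕ Fin c) (k : Fin p) :
    ols n z y (b, k) = Sum.elim (fun i => μ (i, k)) (fun w => ν (w, k)) b +
      ∑ s, lsCoef n z b s * e s.1 s.2 k := by
  set β := Sum.elim (fun i => μ (i, k)) (fun w => ν (w, k)) with hβ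
  have hy' : ∀ s : Subject n, y s.1 s.2 k = (design n z *ᵥ β) s + e s.1 s.2 k := fun s => by
    rw [hy]
    simp [Matrix.mulVec, dotProduct, Fintype.sum_sum_type, design, hβ]
  simp only [ols_apply, hy', mul_add, Finset.sum_add_distrib]
  congr 1
  change (lsCoef n z *ᵥ (design n z *ᵥ β)) b = β b
  rw [Matrix.mulVec_mulVec, lsCoef_mul_design h, Matrix.one_mulVec]

theorem residual_eq_sub_leverage
    (hy : ∀ i j k, y i j k = μ (i, k) + ∑ w, z i j w * ν (w, k) + e i j k)
    (h : IsUnit ((design n z)ᵀ * design n z).det) (s : Subject n) (k : Fin p) :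
    residual n z y s k =
      e s.1 s.2 k - ∑ t, (design n z * lsCoef n z) s t * e t.1 t.2 k := by
  rw [residual_eq_sub_sum, hy]
  simp only [ols_eq_add hy h, mul_add, Finset.sum_add_distrib]
  have h1 : ∑ b, design n z s b * Sum.elim (fun i => μ (i, k)) (fun w => ν (w, k)) b =
      μ (s.1, k) + ∑ w, z s.1 s.2 w * ν (w, k) := by
    simp [Fintype.sum_sum_type, design]
  have h2 : ∑ b, design n z s b * ∑ t, lsCoef n z b t * e t.1 t.2 k =
      ∑ t, (design n z * lsCoef n z) s t * e t.1 t.2 k := by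
    simp only [Matrix.mul_apply, Finset.mul_sum, Finset.sum_mul]
    rw [Finset.sum_comm]
    exact Finset.sum_congr rfl fun t _ => Finset.sum_congr rfl fun b _ => by ring
  rw [h1, h2]
  ring

end Model

end DesignAlgebra

/-! ### Asymptotics of the design: Gram limits, negligibility and limit covariance -/

section DesignLimits

/-- If the partial sums along `f N` of a nonnegative sequence grow linearly, then its terms of
index below `f N` are uniformly `o(N)`. -/
theorem eventually_forall_lt_le_mul {f : ℕ → ℕ} (hf : f 0 = 0) {u : ℕ → ℝ} (hu : ∀ j, 0 ≤ u j)
    {s : ℝ} (h : Tendsto (fun N : ℕ => (N : ℝ)⁻¹ * ∑ j ∈ Finset.range (f N), u j) atTop (𝓝 s))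
    {η : ℝ} (hη : 0 < η) : ∀ᶠ N : ℕ in atTop, ∀ j < f N, u j ≤ η * N := by
  set F : ℕ → ℝ := fun N => ∑ j ∈ Finset.range (f N), u j with hF
  have hF0 : ∀ N, 0 ≤ F N := fun N => Finset.sum_nonneg fun j _ => hu j
  have h1 : Tendsto (fun N : ℕ => ((N : ℝ) + 1)⁻¹ * F (N + 1)) atTop (𝓝 s) := by
    have := h.comp (tendsto_add_atTop_nat 1)
    simpa [Function.comp_def] using this
  have h2 : Tendsto (fun N : ℕ => ((N : ℝ) + 1)⁻¹ * F N) atTop (𝓝 s) := by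
    have h3 := (tendsto_natCast_div_add_atTop (1 : ℝ)).mul h
    rw [one_mul] at h3
    refine h3.congr' ?_
    filter_upwards [eventually_gt_atTop 0] with N hN
    have : (N : ℝ) ≠ 0 := by positivity
    field_simp
    rfl
  -- Two consecutive normalized sums have the same limit, so their increment is `o(N)`; any single
  -- term entering at that step is bounded by the increment.
  have h4 : Tendsto (fun N : ℕ => ((N : ℝ) + 1)⁻¹ * (F (N + 1) - F N)) atTop (𝓝 0) := by
    have := h1.sub h2
    simpa [mul_sub] using this
  obtain ⟨N₀, hN₀⟩ := eventually_atTop.mp (h4.eventually (gt_mem_nhds hη))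
  -- The function `f` need not be monotone, but each index below `f M` is crossed upwards at some
  -- step before `M`, because `f 0 = 0`.
  have hstep : ∀ M j, j < f M → ∃ N < M, f N ≤ j ∧ j < f (N + 1) := by
    intro M
    induction M with
    | zero => intro j hj; omega
    | succ M ih =>
      intro j hj
      by_cases hjM : j < f M
      · obtain ⟨N, hN, h⟩ := ih j hjM
        exact ⟨N, by omega, h⟩
      · exact ⟨M, by omega, by omega, hj⟩
  have hle : ∀ N j, f N ≤ j → j < f (N + 1) → u j ≤ F (N + 1) - F N := by
    intro N j h5 h6
    have : F (N + 1) = F N + ∑ j ∈ Finset.Ico (f N) (f (N + 1)), u j :=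
      (Finset.sum_range_add_sum_Ico _ (by omega)).symm
    rw [this, add_sub_cancel_left]
    exact Finset.single_le_sum (f := u) (fun j _ => hu j) (Finset.mem_Ico.mpr ⟨h5, h6⟩)
  -- Terms entering before step `N₀`, where the increment estimate is not available, are bounded by
  -- this constant, which `η M` eventually exceeds.
  set C := ∑ N ∈ Finset.range (N₀ + 1), F N
  have hC : ∀ᶠ M : ℕ in atTop, C ≤ η * M :=
    (tendsto_natCast_atTop_atTop.const_mul_atTop hη).eventually_ge_atTop C
  filter_upwards [hC] with M hM j hj
  obtain ⟨N, hNM, hN1, hN2⟩ := hstep M j hj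
  have hd := hle N j hN1 hN2
  by_cases hN : N₀ ≤ N
  · have h5 := hN₀ N hN
    rw [inv_mul_lt_iff₀ (by positivity)] at h5
    have h6 : (N : ℝ) + 1 ≤ M := by exact_mod_cast hNM
    nlinarith
  · have h7 : F (N + 1) ≤ C :=
      Finset.single_le_sum (f := F) (fun N _ => hF0 N) (Finset.mem_range.mpr (by omega))
    linarith [hF0 N]

variable {a c : ℕ}

/-- The contribution of group `i₀` to the limit of `N⁻¹ X'X`. -/
def limitGroupGram (κ : Fin a → ℝ) (m : Fin a → Fin c → ℝ) (Ξ : Fin a → Matrix (Fin c) (Fin c) ℝ)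
    (i₀ : Fin a) : Matrix (Fin a ⊕ Fin c) (Fin a ⊕ Fin c) ℝ :=
  (κ i₀)⁻¹ • Matrix.fromBlocks
    (Matrix.of fun i i' => (if i₀ = i then 1 else 0) * (if i₀ = i' then 1 else 0))
    (Matrix.of fun i w => (if i₀ = i then 1 else 0) * m i₀ w)
    (Matrix.of fun w i => m i₀ w * (if i₀ = i then 1 else 0)) (Ξ i₀)

theorem sum_limitGroupGram (κ : Fin a → ℝ) (m : Fin a → Fin c → ℝ)
    (Ξ : Fin a → Matrix (Fin c) (Fin c) ℝ) :
    ∑ i, limitGroupGram κ m Ξ i = limitGram κ m Ξ := by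
  ext b b'
  rcases b with i | w <;> rcases b' with i' | w' <;>
    simp [Matrix.sum_apply, limitGroupGram, limitGram, Matrix.diagonal_apply]
  by_cases h : i = i'
  · subst h; rfl
  · rw [if_neg h, if_neg (Ne.symm h)]

variable {n : ℕ → Fin a → ℕ} {z : Fin a → ℕ → Fin c → ℝ}

theorem tendsto_groupGram {κ : Fin a → ℝ} (hκ : ∀ i, 0 < κ i)
    (hsize : ∀ i, Tendsto (fun N : ℕ => (N : ℝ) / n N i) atTop (𝓝 (κ i)))
    {m : Fin a → Fin c → ℝ} {Ξ : Fin a → Matrix (Fin c) (Fin c) ℝ}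
    (hfirst : ∀ i w, Tendsto
      (fun N => (n N i : ℝ)⁻¹ * ∑ j ∈ Finset.range (n N i), z i j w) atTop (𝓝 (m i w)))
    (hsecond : ∀ i w w', Tendsto
      (fun N => (n N i : ℝ)⁻¹ * ∑ j ∈ Finset.range (n N i), z i j w * z i j w')
      atTop (𝓝 (Ξ i w w'))) (i₀ : Fin a) :
    Tendsto (fun N : ℕ => (N : ℝ)⁻¹ • groupGram (n N) z i₀) atTop
      (𝓝 (limitGroupGram κ m Ξ i₀)) := by
  -- An empty group would give the ratio `N / 0 = 0`, which is excluded near a positive limit.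
  have hne : ∀ᶠ N in atTop, (n N i₀ : ℝ) ≠ 0 := by
    filter_upwards [(hsize i₀).eventually (lt_mem_nhds (hκ i₀))] with N hN h0
    rw [h0, div_zero] at hN
    exact lt_irrefl _ hN
  have hratio : Tendsto (fun N : ℕ => (n N i₀ : ℝ) / N) atTop (𝓝 (κ i₀)⁻¹) := by
    simpa using (hsize i₀).inv₀ (hκ i₀).ne'
  have hone : Tendsto (fun N => (n N i₀ : ℝ)⁻¹ * ∑ _j ∈ Finset.range (n N i₀), (1 : ℝ)) atTop
      (𝓝 1) := by
    refine tendsto_const_nhds.congr' ?_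
    filter_upwards [hne] with N hN
    simp [inv_mul_cancel₀ hN]
  refine tendsto_pi_nhds.mpr fun b => tendsto_pi_nhds.mpr fun b' => ?_
  have key : ∀ {u : ℕ → ℝ} {l : ℝ}, Tendsto
      (fun N => (n N i₀ : ℝ)⁻¹ * ∑ j ∈ Finset.range (n N i₀), u j) atTop (𝓝 l) →
      Tendsto (fun N : ℕ => (N : ℝ)⁻¹ * ∑ j ∈ Finset.range (n N i₀), u j) atTop
        (𝓝 ((κ i₀)⁻¹ * l)) := by
    intro u l hl
    refine (hratio.mul hl).congr' ?_
    filter_upwards [hne] with N hN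
    field_simp
  rcases b with i | w <;> rcases b' with i' | w'
  · have := (key hone).mul_const ((if i₀ = i then (1 : ℝ) else 0) * (if i₀ = i' then 1 else 0))
    simp only [Matrix.smul_apply, groupGram, Matrix.of_apply, designRow, Sum.elim_inl,
      limitGroupGram, Matrix.fromBlocks_apply₁₁, smul_eq_mul]
    simpa [mul_assoc] using this
  · have := (key (hfirst i₀ w')).mul_const (if i₀ = i then (1 : ℝ) else 0)
    simp only [Matrix.smul_apply, groupGram, Matrix.of_apply, designRow, Sum.elim_inl,
      Sum.elim_inr, limitGroupGram, Matrix.fromBlocks_apply₁₂, smul_eq_mul, ← Finset.mul_sum]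
    refine (this.congr fun N => by ring).trans_eq ?_
    congr 1; ring
  · have := (key (hfirst i₀ w)).mul_const (if i₀ = i' then (1 : ℝ) else 0)
    simp only [Matrix.smul_apply, groupGram, Matrix.of_apply, designRow, Sum.elim_inl,
      Sum.elim_inr, limitGroupGram, Matrix.fromBlocks_apply₂₁, smul_eq_mul, ← Finset.sum_mul]
    refine (this.congr fun N => by ring).trans_eq ?_
    congr 1; ring
  · simpa [groupGram, designRow, limitGroupGram] using key (hsecond i₀ w w')

theorem eventually_design_sq_le (hn : ∀ N, ∑ i, n N i = N)
    {Γ : Fin a → Matrix (Fin a ⊕ Fin c) (Fin a ⊕ Fin c) ℝ}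
    (hG : ∀ i, Tendsto (fun N : ℕ => (N : ℝ)⁻¹ • groupGram (n N) z i) atTop (𝓝 (Γ i)))
    {η : ℝ} (hη : 0 < η) :
    ∀ᶠ N : ℕ in atTop, ∀ s b, design (n N) z s b ^ 2 ≤ η * N := by
  have hn0 : ∀ i, n 0 i = 0 := fun i =>
    (Finset.sum_eq_zero_iff.mp (hn 0)) i (Finset.mem_univ i)
  have h : ∀ i b, ∀ᶠ N : ℕ in atTop, ∀ j < n N i, designRow z i j b ^ 2 ≤ η * N := fun i b =>
    eventually_forall_lt_le_mul (hn0 i) (u := fun j => designRow z i j b ^ 2)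
      (fun j => sq_nonneg _) (s := Γ i b b) (by
        have := ((tendsto_pi_nhds.mp ((tendsto_pi_nhds.mp (hG i)) b)) b)
        simpa [groupGram, sq] using this) hη
  filter_upwards [eventually_all.mpr fun i => eventually_all.mpr fun b => h i b] with N hN s b
  rw [design_apply]
  exact hN s.1 b s.2 s.2.2

variable {Γ : Fin a → Matrix (Fin a ⊕ Fin c) (Fin a ⊕ Fin c) ℝ}

theorem tendsto_gram
    (hG : ∀ i, Tendsto (fun N : ℕ => (N : ℝ)⁻¹ • groupGram (n N) z i) atTop (𝓝 (Γ i))) :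
    Tendsto (fun N : ℕ => (N : ℝ)⁻¹ • ((design (n N) z)ᵀ * design (n N) z)) atTop
      (𝓝 (∑ i, Γ i)) := by
  simp only [gram_eq_sum_groupGram, Finset.smul_sum]
  exact tendsto_finsetSum _ fun i _ => hG i

theorem eventually_isUnit_gram
    (hG : ∀ i, Tendsto (fun N : ℕ => (N : ℝ)⁻¹ • groupGram (n N) z i) atTop (𝓝 (Γ i)))
    (hΓ : (∑ i, Γ i).det ≠ 0) :
    ∀ᶠ N in atTop, IsUnit ((design (n N) z)ᵀ * design (n N) z).det := by
  have h : Tendsto (fun N : ℕ => ((N : ℝ)⁻¹ • ((design (n N) z)ᵀ * design (n N) z)).det) atTop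
      (𝓝 (∑ i, Γ i).det) :=
    ((Continuous.matrix_det continuous_id).tendsto _).comp (tendsto_gram hG)
  filter_upwards [h.eventually_ne hΓ] with N hN
  rw [isUnit_iff_ne_zero]
  intro h0
  rw [Matrix.det_smul, h0, mul_zero] at hN
  exact hN rfl

theorem tendsto_gram_inv
    (hG : ∀ i, Tendsto (fun N : ℕ => (N : ℝ)⁻¹ • groupGram (n N) z i) atTop (𝓝 (Γ i)))
    (hΓ : (∑ i, Γ i).det ≠ 0) :
    Tendsto (fun N : ℕ => (N : ℝ) • ((design (n N) z)ᵀ * design (n N) z)⁻¹) atTop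
      (𝓝 (∑ i, Γ i)⁻¹) := by
  refine ((continuousAt_matrix_inv hΓ).tendsto.comp (tendsto_gram hG)).congr' ?_
  filter_upwards [eventually_isUnit_gram hG hΓ, eventually_gt_atTop 0] with N hN hpos
  have hN0 : (N : ℝ) ≠ 0 := by positivity
  refine Matrix.inv_eq_right_inv ?_
  rw [Matrix.smul_mul, Matrix.mul_smul, Matrix.mul_nonsing_inv _ hN, smul_smul,
    inv_mul_cancel₀ hN0, one_smul]

theorem exists_gram_inv_bound
    (hG : ∀ i, Tendsto (fun N : ℕ => (N : ℝ)⁻¹ • groupGram (n N) z i) atTop (𝓝 (Γ i)))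
    (hΓ : (∑ i, Γ i).det ≠ 0) :
    ∃ R : ℝ, 0 < R ∧ ∀ᶠ N : ℕ in atTop, ∀ b b',
      |(N : ℝ) * ((design (n N) z)ᵀ * design (n N) z)⁻¹ b b'| ≤ R := by
  have h : ∀ b b', Tendsto (fun N : ℕ => |(N : ℝ) * ((design (n N) z)ᵀ * design (n N) z)⁻¹ b b'|)
      atTop (𝓝 |(∑ i, Γ i)⁻¹ b b'|) := fun b b' =>
    (tendsto_pi_nhds.mp ((tendsto_pi_nhds.mp (tendsto_gram_inv hG hΓ)) b) b').abs
  refine ⟨∑ b, ∑ b', |(∑ i, Γ i)⁻¹ b b'| + 1, by positivity, ?_⟩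
  refine eventually_all.mpr fun b => eventually_all.mpr fun b' => ?_
  refine (h b b').eventually_le_const (lt_of_le_of_lt ?_ (lt_add_one _))
  refine le_trans ?_ (Finset.single_le_sum (f := fun b => ∑ b', |(∑ i, Γ i)⁻¹ b b'|)
    (fun b _ => Finset.sum_nonneg fun b' _ => abs_nonneg _) (Finset.mem_univ b))
  exact Finset.single_le_sum (f := fun b' => |(∑ i, Γ i)⁻¹ b b'|)
    (fun b' _ => abs_nonneg _) (Finset.mem_univ b')

/-- Each coefficient is a row of `(X'X)⁻¹`, of order `1 / N`, applied to a design row with entries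
`o(√N)`. Hence it is uniformly `o(1 / √N)`. -/
theorem eventually_lsCoef_sq_le (hn : ∀ N, ∑ i, n N i = N)
    (hG : ∀ i, Tendsto (fun N : ℕ => (N : ℝ)⁻¹ • groupGram (n N) z i) atTop (𝓝 (Γ i)))
    (hΓ : (∑ i, Γ i).det ≠ 0) {η : ℝ} (hη : 0 < η) :
    ∀ᶠ N : ℕ in atTop, ∀ b s, (N : ℝ) * lsCoef (n N) z b s ^ 2 ≤ η := by
  obtain ⟨R, hR, hbd⟩ := exists_gram_inv_bound hG hΓ
  set B : ℝ := (Fintype.card (Fin a ⊕ Fin c) : ℝ) with hB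
  have hB0 : 0 ≤ B := by positivity
  -- `R²` bounds the scaled inverse entries. One factor `B` comes from Cauchy–Schwarz and one from
  -- summing over the `B` columns; `B + 1` avoids division by zero.
  have hη' : 0 < η / ((B + 1) ^ 2 * R ^ 2) := by positivity
  filter_upwards [hbd, eventually_design_sq_le hn hG hη', eventually_gt_atTop 0]
    with N hN hX hpos b s
  have hN0 : (0 : ℝ) < N := by positivity
  set D := ((design (n N) z)ᵀ * design (n N) z)⁻¹ with hD
  have hc : lsCoef (n N) z b s = ∑ e, D b e * design (n N) z s e := by
    simp [lsCoef, Matrix.mul_apply, ← hD]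
  have h1 : ∀ e, (N * (D b e * design (n N) z s e)) ^ 2 ≤
      R ^ 2 * (η / ((B + 1) ^ 2 * R ^ 2) * N) := fun e => by
    rw [← mul_assoc, mul_pow]
    exact mul_le_mul (sq_le_sq.mpr (by rw [abs_of_pos hR]; exact hN b e)) (hX s e) (sq_nonneg _)
      (sq_nonneg _)
  have h2 : (N * lsCoef (n N) z b s) ^ 2 ≤ B * ∑ e, (N * (D b e * design (n N) z s e)) ^ 2 := by
    rw [hc, Finset.mul_sum]
    have := sq_sum_le_card_mul_sum_sq (s := Finset.univ)
      (f := fun e => N * (D b e * design (n N) z s e))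
    simpa [hB] using this
  have h3 : ∑ e, (N * (D b e * design (n N) z s e)) ^ 2 ≤
      B * (R ^ 2 * (η / ((B + 1) ^ 2 * R ^ 2) * N)) := by
    refine (Finset.sum_le_sum fun e _ => h1 e).trans ?_
    simp [hB]
  have h4 : (N * lsCoef (n N) z b s) ^ 2 ≤ N * η := by
    calc _ ≤ B * (B * (R ^ 2 * (η / ((B + 1) ^ 2 * R ^ 2) * N))) :=
          h2.trans (mul_le_mul_of_nonneg_left h3 hB0)
      _ = (B ^ 2 / (B + 1) ^ 2) * (N * η) := by field_simp
      _ ≤ 1 * (N * η) := by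
        gcongr
        rw [div_le_one (by positivity)]
        nlinarith
      _ = _ := one_mul _
  have h5 : (N : ℝ) * (N * lsCoef (n N) z b s ^ 2) ≤ N * η := by
    calc _ = (N * lsCoef (n N) z b s) ^ 2 := by ring
      _ ≤ _ := h4
  exact le_of_mul_le_mul_left h5 hN0

/-- The leverage is a sum of products of a design entry and a coefficient, and `x c ≤ (x² / N + N
c²) / 2` splits each product into two quantities already known to vanish uniformly. -/
theorem eventually_leverage_le (hn : ∀ N, ∑ i, n N i = N)
    (hG : ∀ i, Tendsto (fun N : ℕ => (N : ℝ)⁻¹ • groupGram (n N) z i) atTop (𝓝 (Γ i)))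
    (hΓ : (∑ i, Γ i).det ≠ 0) {η : ℝ} (hη : 0 < η) :
    ∀ᶠ N : ℕ in atTop, ∀ s, ∑ t, (design (n N) z * lsCoef (n N) z) s t ^ 2 ≤ η := by
  set B : ℝ := (Fintype.card (Fin a ⊕ Fin c) : ℝ) with hB
  have hη' : 0 < η / (B + 1) := by positivity
  filter_upwards [eventually_isUnit_gram hG hΓ, eventually_design_sq_le hn hG hη',
    eventually_lsCoef_sq_le hn hG hΓ hη', eventually_gt_atTop 0] with N hu hX hc hpos s
  have hN0 : (0 : ℝ) < N := by positivity
  rw [sum_leverage_sq hu]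
  calc ∑ b, design (n N) z s b * lsCoef (n N) z b s ≤ ∑ _b : Fin a ⊕ Fin c, η / (B + 1) := by
        refine Finset.sum_le_sum fun b _ => ?_
        have h1 := hX s b
        have h2 := hc b s
        have h3 : design (n N) z s b * lsCoef (n N) z b s ≤
            (design (n N) z s b ^ 2 / N + N * lsCoef (n N) z b s ^ 2) / 2 := by
          have h4 : design (n N) z s b ^ 2 / N + N * lsCoef (n N) z b s ^ 2 -
              2 * (design (n N) z s b * lsCoef (n N) z b s) =
              (design (n N) z s b - N * lsCoef (n N) z b s) ^ 2 / N := by field_simp; ring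
          have h5 : 0 ≤ (design (n N) z s b - N * lsCoef (n N) z b s) ^ 2 / N := by positivity
          linarith
        have h6 : design (n N) z s b ^ 2 / N ≤ η / (B + 1) := by
          rwa [div_le_iff₀ hN0]
        linarith
    _ = B / (B + 1) * η := by rw [Finset.sum_const, nsmul_eq_mul, Finset.card_univ, ← hB]; ring
    _ ≤ 1 * η := by
      gcongr
      rw [div_le_one (by positivity)]
      linarith
    _ = η := one_mul _

/-- The sums of squares are the diagonal entries of `N (X'X)⁻¹`, which stay bounded; mixed products
follow from the arithmetic–geometric mean inequality. -/
theorem exists_sum_abs_lsCoef_bound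
    (hG : ∀ i, Tendsto (fun N : ℕ => (N : ℝ)⁻¹ • groupGram (n N) z i) atTop (𝓝 (Γ i)))
    (hΓ : (∑ i, Γ i).det ≠ 0) :
    ∃ R : ℝ, 0 < R ∧ ∀ᶠ N : ℕ in atTop, ∀ b b',
      ∑ s, |(N : ℝ) * (lsCoef (n N) z b s * lsCoef (n N) z b' s)| ≤ R := by
  obtain ⟨R, hR, hbd⟩ := exists_gram_inv_bound hG hΓ
  refine ⟨R, hR, ?_⟩
  filter_upwards [eventually_isUnit_gram hG hΓ, hbd] with N hu hN b b'
  have hsum : ∀ e, ∑ s, (N : ℝ) * lsCoef (n N) z e s ^ 2 ≤ R := fun e => by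
    have h := congrFun (congrFun (lsCoef_mul_transpose hu) e) e
    rw [Matrix.mul_apply] at h
    simp only [Matrix.transpose_apply] at h
    rw [← Finset.mul_sum]
    simp only [sq]
    rw [h]
    exact (le_abs_self _).trans (hN e e)
  calc _ ≤ ∑ s, ((N : ℝ) * lsCoef (n N) z b s ^ 2 + (N : ℝ) * lsCoef (n N) z b' s ^ 2) / 2 := by
        refine Finset.sum_le_sum fun s _ => ?_
        rw [abs_mul, abs_mul, Nat.abs_cast, ← sq_abs (lsCoef (n N) z b s),
          ← sq_abs (lsCoef (n N) z b' s)]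
        have h1 : (0 : ℝ) ≤ N := by positivity
        nlinarith [mul_nonneg h1 (sq_nonneg (|lsCoef (n N) z b s| - |lsCoef (n N) z b' s|))]
    _ = (∑ s, (N : ℝ) * lsCoef (n N) z b s ^ 2 + ∑ s, (N : ℝ) * lsCoef (n N) z b' s ^ 2) / 2 := by
      rw [← Finset.sum_div, Finset.sum_add_distrib]
    _ ≤ R := by linarith [hsum b, hsum b']

/-- The limit covariance matrix of the normalized least squares estimator of `(μ, ν)`. -/
def limitCov {p : ℕ} (Γ : Fin a → Matrix (Fin a ⊕ Fin c) (Fin a ⊕ Fin c) ℝ)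
    (Sig : Fin a → Matrix (Fin p) (Fin p) ℝ) :
    Matrix ((Fin a ⊕ Fin c) × Fin p) ((Fin a ⊕ Fin c) × Fin p) ℝ :=
  ∑ i, ((∑ i, Γ i)⁻¹ * Γ i * (∑ i, Γ i)⁻¹) ⊗ₖ Sig i

theorem tendsto_sum_lsCoef_cov {p : ℕ}
    (hG : ∀ i, Tendsto (fun N : ℕ => (N : ℝ)⁻¹ • groupGram (n N) z i) atTop (𝓝 (Γ i)))
    (hΓ : (∑ i, Γ i).det ≠ 0) (Sig : Fin a → Matrix (Fin p) (Fin p) ℝ)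
    (b b' : Fin a ⊕ Fin c) (k l : Fin p) :
    Tendsto (fun N : ℕ => ∑ s, (N : ℝ) * (lsCoef (n N) z b s * lsCoef (n N) z b' s) *
      Sig s.1 k l) atTop (𝓝 (limitCov Γ Sig (b, k) (b', l))) := by
  have h : ∀ i, Tendsto (fun N : ℕ => (N : ℝ) • (((design (n N) z)ᵀ * design (n N) z)⁻¹ *
      groupGram (n N) z i * ((design (n N) z)ᵀ * design (n N) z)⁻¹)) atTop
      (𝓝 ((∑ i, Γ i)⁻¹ * Γ i * (∑ i, Γ i)⁻¹)) := fun i => by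
    have hD := tendsto_gram_inv hG hΓ
    have hmul : Continuous fun q : Matrix (Fin a ⊕ Fin c) (Fin a ⊕ Fin c) ℝ ×
        Matrix (Fin a ⊕ Fin c) (Fin a ⊕ Fin c) ℝ => q.1 * q.2 :=
      continuous_fst.matrix_mul continuous_snd
    have h1 := (hmul.tendsto _).comp (hD.prodMk_nhds (hG i))
    have h2 := (hmul.tendsto _).comp (h1.prodMk_nhds hD)
    refine h2.congr' ?_
    filter_upwards [eventually_gt_atTop 0] with N hpos
    have hN0 : (N : ℝ) ≠ 0 := by positivity
    simp only [Function.comp_apply, Matrix.smul_mul, Matrix.mul_smul, smul_smul]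
    congr 1
    field_simp
  have h3 : Tendsto (fun N : ℕ => ∑ i, Sig i k l * ((N : ℝ) •
      (((design (n N) z)ᵀ * design (n N) z)⁻¹ * groupGram (n N) z i *
        ((design (n N) z)ᵀ * design (n N) z)⁻¹)) b b') atTop
      (𝓝 (∑ i, Sig i k l * ((∑ i, Γ i)⁻¹ * Γ i * (∑ i, Γ i)⁻¹) b b')) :=
    tendsto_finsetSum _ fun i _ =>
      (tendsto_pi_nhds.mp ((tendsto_pi_nhds.mp (h i)) b) b').const_mul _
  have h4 : limitCov Γ Sig (b, k) (b', l) =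
      ∑ i, Sig i k l * ((∑ i, Γ i)⁻¹ * Γ i * (∑ i, Γ i)⁻¹) b b' := by
    simp [limitCov, Matrix.sum_apply, mul_comm]
  rw [h4]
  refine h3.congr fun N => ?_
  have h5 := sum_lsCoef_group (n N) z (fun i => Sig i k l) b b'
  calc _ = (N : ℝ) * ∑ i, Sig i k l * (((design (n N) z)ᵀ * design (n N) z)⁻¹ * groupGram (n N) z i *
        ((design (n N) z)ᵀ * design (n N) z)⁻¹) b b' := by
        rw [Finset.mul_sum]
        exact Finset.sum_congr rfl fun i _ => by rw [Matrix.smul_apply, smul_eq_mul]; ring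
    _ = _ := by
      rw [← h5, Finset.mul_sum]
      exact Finset.sum_congr rfl fun s _ => by ring

/-- The quadratic forms along the sequence are sums of squares, and nonnegativity passes to the
limit. -/
theorem posSemidef_of_tendsto_groupGram
    (hG : ∀ i, Tendsto (fun N : ℕ => (N : ℝ)⁻¹ • groupGram (n N) z i) atTop (𝓝 (Γ i)))
    (i : Fin a) : (Γ i).PosSemidef := by
  have hent : ∀ b b', Tendsto (fun N : ℕ => ((N : ℝ)⁻¹ • groupGram (n N) z i) b b') atTop
      (𝓝 (Γ i b b')) := fun b b' =>
    tendsto_pi_nhds.mp ((tendsto_pi_nhds.mp (hG i)) b) b'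
  have hsymm : ∀ (N : ℕ) b b', ((N : ℝ)⁻¹ • groupGram (n N) z i) b b' =
      ((N : ℝ)⁻¹ • groupGram (n N) z i) b' b := fun N b b' => by
    simp [groupGram, mul_comm]
  refine Matrix.PosSemidef.of_dotProduct_mulVec_nonneg ?_ fun v => ?_
  · ext b b'
    exact tendsto_nhds_unique ((hent b' b).congr fun N => hsymm N b' b) (hent b b')
  · have hlim : Tendsto (fun N : ℕ => star v ⬝ᵥ (((N : ℝ)⁻¹ • groupGram (n N) z i) *ᵥ v)) atTop
        (𝓝 (star v ⬝ᵥ (Γ i *ᵥ v))) :=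
      ((continuous_const.dotProduct
        (continuous_id.matrix_mulVec continuous_const)).tendsto _).comp (hG i)
    refine ge_of_tendsto' hlim fun N => ?_
    have : star v ⬝ᵥ (((N : ℝ)⁻¹ • groupGram (n N) z i) *ᵥ v) =
        (N : ℝ)⁻¹ * ∑ j ∈ Finset.range (n N i), (∑ b, v b * designRow z i j b) ^ 2 := by
      rw [Matrix.smul_mulVec, dotProduct_smul, smul_eq_mul]
      congr 1
      simp only [dotProduct, Matrix.mulVec, groupGram, Matrix.of_apply, star_trivial, sq,
        Finset.sum_mul, Finset.mul_sum]
      rw [Finset.sum_comm]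
      conv_rhs => rw [Finset.sum_comm]
      refine Finset.sum_congr rfl fun b' _ => ?_
      rw [Finset.sum_comm]
      exact Finset.sum_congr rfl fun j _ => Finset.sum_congr rfl fun b _ => by ring
    rw [this]
    positivity

/-- The individual summands may be singular. A null vector of their sum is a null vector of each
one; stripping the invertible `Sig i` leaves the factors `G⁻¹ Γ i G⁻¹ ⊗ 1`, which add up to the
invertible `G⁻¹ ⊗ 1`, so the vector is zero. -/
theorem posDef_limitCov {p : ℕ} (hΓ : (∑ i, Γ i).det ≠ 0) (hpos : ∀ i, (Γ i).PosSemidef)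
    {Sig : Fin a → Matrix (Fin p) (Fin p) ℝ} (hSig : ∀ i, (Sig i).PosDef) :
    (limitCov Γ Sig).PosDef := by
  set G := ∑ i, Γ i with hGdef
  have hGs : G.PosSemidef := Matrix.posSemidef_sum _ fun i _ => hpos i
  have hGt : (G⁻¹)ᴴ = G⁻¹ := hGs.inv.isHermitian
  have hA : ∀ i, (G⁻¹ * Γ i * G⁻¹).PosSemidef := fun i => by
    have := (hpos i).conjTranspose_mul_mul_same G⁻¹
    rwa [hGt] at this
  have hAS : ∀ i, ((G⁻¹ * Γ i * G⁻¹) ⊗ₖ Sig i).PosSemidef := fun i =>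
    (hA i).kronecker (hSig i).posSemidef
  have hV : (limitCov Γ Sig).PosSemidef := Matrix.posSemidef_sum _ fun i _ => hAS i
  have hdet : IsUnit G.det := isUnit_iff_ne_zero.mpr hΓ
  refine Matrix.PosDef.of_dotProduct_mulVec_pos hV.isHermitian fun v hv => ?_
  refine lt_of_le_of_ne (hV.dotProduct_mulVec_nonneg v) fun h0 => hv ?_
  have hsum : ∑ i, star v ⬝ᵥ (((G⁻¹ * Γ i * G⁻¹) ⊗ₖ Sig i) *ᵥ v) = 0 := by
    rw [h0, limitCov, Matrix.sum_mulVec, dotProduct_sum]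
  have hz : ∀ i, ((G⁻¹ * Γ i * G⁻¹) ⊗ₖ Sig i) *ᵥ v = 0 := fun i =>
    ((hAS i).dotProduct_mulVec_zero_iff v).mp
      ((Finset.sum_eq_zero_iff_of_nonneg fun i _ => (hAS i).dotProduct_mulVec_nonneg v).mp hsum i
        (Finset.mem_univ i))
  have hz1 : ∀ i, ((G⁻¹ * Γ i * G⁻¹) ⊗ₖ (1 : Matrix (Fin p) (Fin p) ℝ)) *ᵥ v = 0 := fun i => by
    have hS : IsUnit (Sig i).det := isUnit_iff_ne_zero.mpr (hSig i).det_pos.ne'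
    have := congrArg (((1 : Matrix (Fin a ⊕ Fin c) (Fin a ⊕ Fin c) ℝ) ⊗ₖ (Sig i)⁻¹) *ᵥ ·) (hz i)
    simpa [Matrix.mulVec_mulVec, ← Matrix.mul_kronecker_mul, Matrix.nonsing_inv_mul _ hS]
      using this
  have hinv : (G⁻¹ ⊗ₖ (1 : Matrix (Fin p) (Fin p) ℝ)) *ᵥ v = 0 := by
    have h1 : ∑ i, (G⁻¹ * Γ i * G⁻¹) = G⁻¹ := by
      rw [← Finset.sum_mul, ← Finset.mul_sum, ← hGdef, Matrix.nonsing_inv_mul _ hdet,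
        Matrix.one_mul]
    rw [← h1]
    have h2 : (∑ i, (G⁻¹ * Γ i * G⁻¹)) ⊗ₖ (1 : Matrix (Fin p) (Fin p) ℝ) =
        ∑ i, (G⁻¹ * Γ i * G⁻¹) ⊗ₖ (1 : Matrix (Fin p) (Fin p) ℝ) := by
      ext x y
      simp [Matrix.sum_apply, Finset.sum_mul]
    rw [h2, Matrix.sum_mulVec]
    exact Finset.sum_eq_zero fun i _ => hz1 i
  have := congrArg ((G ⊗ₖ (1 : Matrix (Fin p) (Fin p) ℝ)) *ᵥ ·) hinv
  simpa [Matrix.mulVec_mulVec, ← Matrix.mul_kronecker_mul, Matrix.mul_nonsing_inv _ hdet] using this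

end DesignLimits

/-! ### Convergence in probability to a constant -/

section ConvergenceInMeasure

variable {Ω : Type*} [MeasurableSpace Ω] {P : Measure Ω}

/-- Markov's inequality. -/
theorem tendstoInMeasure_of_tendsto_integral_abs [IsProbabilityMeasure P]
    {A : ℕ → Ω → ℝ} {c : ℝ}
    (hint : ∀ᶠ N in atTop, Integrable (A N) P)
    (h : Tendsto (fun N => ∫ ω, |A N ω - c| ∂P) atTop (𝓝 0)) :
    TendstoInMeasure P A atTop fun _ => c := by
  rw [tendstoInMeasure_iff_measureReal_norm]
  intro δ hδ
  have h2 := h.div_const δ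
  rw [zero_div] at h2
  refine tendsto_of_tendsto_of_tendsto_of_le_of_le' tendsto_const_nhds h2
    (Eventually.of_forall fun N => measureReal_nonneg) ?_
  filter_upwards [hint] with N hN
  rw [le_div_iff₀ hδ, mul_comm]
  exact mul_meas_ge_le_integral_of_nonneg (Eventually.of_forall fun ω => abs_nonneg _)
    (hN.sub (integrable_const c)).abs δ

/-- In the sup metric a large distance requires some coordinate to be far, so a finite union bound
applies. -/
theorem tendstoInMeasure_pi_const {ι : Type*} [Fintype ι] {E : ι → Type*}
    [∀ i, PseudoEMetricSpace (E i)] {A : ℕ → Ω → ∀ i, E i} {c : ∀ i, E i}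
    (h : ∀ i, TendstoInMeasure P (fun N ω => A N ω i) atTop fun _ => c i) :
    TendstoInMeasure P A atTop fun _ => c := by
  refine tendstoInMeasure_of_ne_top fun δ hδ _ => ?_
  have hsum : Tendsto (fun N => ∑ i, P {ω | δ ≤ edist (A N ω i) (c i)}) atTop (𝓝 0) := by
    simpa using tendsto_finsetSum Finset.univ fun i _ => h i δ hδ
  refine tendsto_of_tendsto_of_tendsto_of_le_of_le tendsto_const_nhds hsum
    (fun N => zero_le) fun N => ?_
  refine (measure_mono fun ω hω => ?_).trans (measure_iUnion_fintype_le P _)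
  simp only [Set.mem_ofPred_eq, Set.mem_iUnion] at hω ⊢
  by_contra! hlt
  rw [edist_pi_def] at hω
  exact absurd hω (not_le.mpr ((Finset.sup_lt_iff hδ).mpr fun i _ => hlt i))

theorem tendsto_measure_notMem_of_tendstoInMeasure {E : Type*} [PseudoEMetricSpace E]
    {A : ℕ → Ω → E} {c : E} (h : TendstoInMeasure P A atTop fun _ => c) {U : Set E}
    (hU : U ∈ 𝓝 c) : Tendsto (fun N => P {ω | A N ω ∉ U}) atTop (𝓝 0) := by
  obtain ⟨δ, hδ, hball⟩ := EMetric.mem_nhds_iff.mp hU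
  refine tendsto_of_tendsto_of_tendsto_of_le_of_le tendsto_const_nhds (h δ hδ)
    (fun N => zero_le) fun N => measure_mono fun ω hω => ?_
  by_contra hlt
  exact hω (hball (Metric.mem_eball.mpr (lt_of_not_ge hlt)))

theorem tendstoInMeasure_continuousAt_comp {E F : Type*} [PseudoEMetricSpace E]
    [PseudoEMetricSpace F] {A : ℕ → Ω → E} {c : E}
    (h : TendstoInMeasure P A atTop fun _ => c) {g : E → F} (hg : ContinuousAt g c) :
    TendstoInMeasure P (fun N ω => g (A N ω)) atTop fun _ => g c := by
  intro δ hδ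
  have hU : {x | edist (g x) (g c) < δ} ∈ 𝓝 c := hg (Metric.eball_mem_nhds _ hδ)
  simpa using tendsto_measure_notMem_of_tendstoInMeasure h hU

end ConvergenceInMeasure

/-! ### Moment bounds for the errors and consistency of the White estimator -/

section Errors

variable {Ω : Type*} [MeasurableSpace Ω] {P : Measure Ω} {a c p : ℕ}

/-- Independent centered errors with group covariance matrices `Sig` whose second and fourth
moments are bounded by `K`. -/
structure IsErrorArray (P : Measure Ω) (ε : Fin a → ℕ → Ω → Fin p → ℝ)
    (Sig : Fin a → Matrix (Fin p) (Fin p) ℝ) (K : ℝ) : Prop where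
  measurable : ∀ i j, Measurable (ε i j)
  indep : iIndepFun (fun s : Fin a × ℕ => ε s.1 s.2) P
  mean : ∀ i j k, P[fun ω => ε i j ω k] = 0
  cov : ∀ i j k l, ∫ ω, ε i j ω k * ε i j ω l ∂P = Sig i k l
  integrable_pow_four : ∀ i j k, Integrable (fun ω => ε i j ω k ^ 4) P
  sq_le : ∀ i j k, ∫ ω, ε i j ω k ^ 2 ∂P ≤ K
  pow_four_le : ∀ i j k, ∫ ω, ε i j ω k ^ 4 ∂P ≤ K
  nonneg : 0 ≤ K

namespace IsErrorArray

variable {ε : Fin a → ℕ → Ω → Fin p → ℝ} {Sig : Fin a → Matrix (Fin p) (Fin p) ℝ} {K : ℝ}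

theorem measurable_apply (h : IsErrorArray P ε Sig K) (i : Fin a) (j : ℕ) (k : Fin p) :
    Measurable fun ω => ε i j ω k :=
  (measurable_pi_apply k).comp (h.measurable i j)

theorem memLp [IsProbabilityMeasure P] (h : IsErrorArray P ε Sig K) (i : Fin a) (j : ℕ)
    (k : Fin p) :
    MemLp (fun ω => ε i j ω k) 2 P :=
  memLp_two_of_pow_four (h.measurable_apply i j k) (h.integrable_pow_four i j k)

theorem indep_subject (h : IsErrorArray P ε Sig K) (n : Fin a → ℕ) :
    iIndepFun (fun s : Subject n => ε s.1 s.2) P := by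
  refine h.indep.precomp (g := fun s : Subject n => ((s.1, (s.2 : ℕ)) : Fin a × ℕ)) ?_
  rintro ⟨i, j⟩ ⟨i', j'⟩ hij
  simp only [Prod.mk.injEq] at hij
  obtain ⟨rfl, hj⟩ := hij
  rw [Fin.ext hj]

end IsErrorArray

/-- Second moments `v` need no separate assumption: `v² ≤ C₁` and `2 v ≤ v² + 1` bound them by `1 +
|C₁|`, which also serves for the fourth moments. -/
theorem isErrorArray_of_moments [IsProbabilityMeasure P] {ε : Fin a → ℕ → Ω → Fin p → ℝ}
    {Sig : Fin a → Matrix (Fin p) (Fin p) ℝ}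
    (hmeas : ∀ i j, Measurable (ε i j)) (hindep : iIndepFun (fun s : Fin a × ℕ => ε s.1 s.2) P)
    (hmean : ∀ i j k, P[fun ω => ε i j ω k] = 0)
    (hcov : ∀ i j k l, cov[fun ω => ε i j ω k, fun ω => ε i j ω l; P] = Sig i k l)
    (hfourth : ∃ C₁ : ℝ, ∀ i j k, Integrable (fun ω => ε i j ω k ^ 4) P ∧
      P[fun ω => ε i j ω k ^ 4] ≤ C₁) : ∃ K, IsErrorArray P ε Sig K := by
  obtain ⟨C₁, hC⟩ := hfourth
  have hm : ∀ i j k, Measurable fun ω => ε i j ω k := fun i j k =>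
    (measurable_pi_apply k).comp (hmeas i j)
  refine ⟨1 + |C₁|, hmeas, hindep, hmean, fun i j k l => ?_, fun i j k => (hC i j k).1,
    fun i j k => ?_, fun i j k => ?_, by positivity⟩
  · rw [← hcov i j k l, covariance, hmean, hmean]
    simp
  · have h1 := sq_integral_sq_le (hm i j k) (hC i j k).1
    have h2 := (hC i j k).2
    have h3 := le_abs_self C₁
    nlinarith [sq_nonneg (∫ ω, ε i j ω k ^ 2 ∂P - 1)]
  · linarith [(hC i j k).2, le_abs_self C₁]

variable {ε : Fin a → ℕ → Ω → Fin p → ℝ} {Sig : Fin a → Matrix (Fin p) (Fin p) ℝ} {K : ℝ}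
  {n : ℕ → Fin a → ℕ} {z : Fin a → ℕ → Fin c → ℝ}
  {Γ : Fin a → Matrix (Fin a ⊕ Fin c) (Fin a ⊕ Fin c) ℝ}
  {μ : Fin a × Fin p → ℝ} {ν : Fin c × Fin p → ℝ} {Y : Fin a → ℕ → Ω → Fin p → ℝ}

/-- Consistency of the White estimator. -/
theorem tendstoInMeasure_sigmaHat [IsProbabilityMeasure P] (hε : IsErrorArray P ε Sig K)
    (hmodel : ∀ i j ω k, Y i j ω k = μ (i, k) + ∑ w, z i j w * ν (w, k) + ε i j ω k)
    (hn : ∀ N, ∑ i, n N i = N)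
    (hG : ∀ i, Tendsto (fun N : ℕ => (N : ℝ)⁻¹ • groupGram (n N) z i) atTop (𝓝 (Γ i)))
    (hΓ : (∑ i, Γ i).det ≠ 0) (i i' : Fin a) (k l : Fin p) :
    TendstoInMeasure P
      (fun (N : ℕ) ω => (N : ℝ) * sigmaHat (n N) z (fun i j => Y i j ω) (i, k) (i', l)) atTop fun _ => limitCov Γ Sig (Sum.inl i, k) (Sum.inl i', l) := by
  set A : ℕ → Ω → ℝ := fun (N : ℕ) ω => (N : ℝ) * sigmaHat (n N) z (fun i j => Y i j ω) (i, k) (i', l)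
  set v := limitCov Γ Sig (Sum.inl i, k) (Sum.inl i', l)
  let w : ∀ N, Subject (n N) → ℝ := fun N s =>
    (N : ℝ) * (lsCoef (n N) z (Sum.inl i) s * lsCoef (n N) z (Sum.inl i') s)
  let h : ∀ N, Subject (n N) → Subject (n N) → ℝ := fun N => design (n N) z * lsCoef (n N) z
  -- This deterministic centering uses the true covariances. It converges by the design limits
  -- alone, so randomness is confined to the `L¹` distance of `A N` from `cN N`.
  let cN : ℕ → ℝ := fun N => ∑ s, w N s * ∫ ω, ε s.1 s.2 ω k * ε s.1 s.2 ω l ∂P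
  have hcN : Tendsto cN atTop (𝓝 v) := by
    simpa [cN, hε.cov, w] using
      tendsto_sum_lsCoef_cov hG hΓ Sig (Sum.inl i) (Sum.inl i') k l
  have hA : ∀ᶠ N in atTop, ∀ ω, A N ω = ∑ s, w N s *
      ((ε s.1 s.2 ω k - ∑ t, h N s t * ε t.1 t.2 ω k) *
        (ε s.1 s.2 ω l - ∑ t, h N s t * ε t.1 t.2 ω l)) := by
    filter_upwards [eventually_isUnit_gram hG hΓ] with N hN ω
    simp only [A, sigmaHat_apply, Finset.mul_sum]
    refine Finset.sum_congr rfl fun s _ => ?_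
    rw [residual_eq_sub_leverage (fun i j k => hmodel i j ω k) hN,
      residual_eq_sub_leverage (fun i j k => hmodel i j ω k) hN]
    simp only [w, h]
    ring
  have hr : ∀ (N : ℕ) (s : Subject (n N)) (m : Fin p), MemLp (fun ω => ε s.1 s.2 ω m - ∑ t, h N s t * ε t.1 t.2 ω m) 2 P :=
    fun N s m => (hε.memLp s.1 s.2 m).sub
      (memLp_finsetSum _ fun t _ => (hε.memLp t.1 t.2 m).const_mul _)
  have hint : ∀ᶠ N in atTop, Integrable (A N) P := by
    filter_upwards [hA] with N hN
    rw [funext hN]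
    exact integrable_finsetSum _ fun s _ => ((hr N s k).integrable_mul (hr N s l)).const_mul _
  obtain ⟨C, hC, hsum⟩ := exists_sum_abs_lsCoef_bound hG hΓ
  have hbound : ∀ η : ℝ, 0 < η → ∀ᶠ N in atTop, ∫ ω, |A N ω - cN N| ∂P ≤
      √η * (C * K + 1) / 2 + C * (2 * K * √η + K * η) := by
    intro η hη
    filter_upwards [hA, hsum, eventually_lsCoef_sq_le hn hG hΓ hη,
      eventually_leverage_le hn hG hΓ hη] with N hN hs hc hl
    simp only [hN]
    refine integral_abs_weighted_residual_le (S := Subject (n N))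
      (x := fun s ω => ε s.1 s.2 ω k) (y := fun s ω => ε s.1 s.2 ω l) (w := w N) (h := h N) (fun s => hε.measurable_apply s.1 s.2 k)
      (fun s => hε.measurable_apply s.1 s.2 l)
      ((hε.indep_subject (n N)).comp (fun _ x => (x k, x l)) fun _ => by fun_prop)
      (fun s => hε.mean _ _ _) (fun s => hε.mean _ _ _)
      (fun s => hε.integrable_pow_four _ _ _) (fun s => hε.integrable_pow_four _ _ _)
      (fun s => hε.sq_le _ _ _) (fun s => hε.sq_le _ _ _)
      (fun s => hε.pow_four_le _ _ _) (fun s => hε.pow_four_le _ _ _) hε.nonneg hη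
      (fun s => ?_) (hs _ _) hl
    have h1 := hc (Sum.inl i) s
    have h2 := hc (Sum.inl i') s
    simp only [w]
    rw [abs_mul, abs_mul, Nat.abs_cast]
    rw [← sq_abs] at h1 h2
    have h3 : (0 : ℝ) ≤ N := by positivity
    nlinarith [mul_nonneg h3 (sq_nonneg
      (|lsCoef (n N) z (Sum.inl i) s| - |lsCoef (n N) z (Sum.inl i') s|))]
  have hmain : Tendsto (fun N => ∫ ω, |A N ω - cN N| ∂P) atTop (𝓝 0) := by
    have hlim : Tendsto (fun η : ℝ => √η * (C * K + 1) / 2 + C * (2 * K * √η + K * η))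
        (𝓝[>] 0) (𝓝 0) := by
      have : Continuous fun η : ℝ => √η * (C * K + 1) / 2 + C * (2 * K * √η + K * η) := by
        fun_prop
      have h0 := this.tendsto 0
      simp only [Real.sqrt_zero, zero_mul, zero_div, mul_zero, add_zero] at h0
      exact h0.mono_left nhdsWithin_le_nhds
    rw [Metric.tendsto_atTop']
    intro δ hδ
    obtain ⟨η, hη, hηδ⟩ := ((hlim.eventually (gt_mem_nhds hδ)).and self_mem_nhdsWithin).exists
    obtain ⟨N₀, hN₀⟩ := eventually_atTop.mp (hbound η hηδ)
    refine ⟨N₀, fun N hN => ?_⟩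
    rw [Real.dist_0_eq_abs, abs_of_nonneg (integral_nonneg fun ω => abs_nonneg _)]
    exact (hN₀ N hN.le).trans_lt hη
  refine tendstoInMeasure_of_tendsto_integral_abs hint ?_
  have hup : Tendsto (fun N => ∫ ω, |A N ω - cN N| ∂P + |cN N - v|) atTop (𝓝 0) := by
    have := hmain.add ((hcN.sub_const v).abs)
    simpa using this
  refine tendsto_of_tendsto_of_tendsto_of_le_of_le' tendsto_const_nhds hup
    (Eventually.of_forall fun N => integral_nonneg fun ω => abs_nonneg _) ?_
  filter_upwards [hint] with N hN
  have hi : Integrable (fun ω => |A N ω - cN N|) P := (hN.sub (integrable_const _)).abs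
  calc ∫ ω, |A N ω - v| ∂P ≤ ∫ ω, (|A N ω - cN N| + |cN N - v|) ∂P :=
        integral_mono (hN.sub (integrable_const v)).abs (hi.add (integrable_const _))
          fun ω => abs_sub_le _ _ _
    _ = _ := by rw [integral_add hi (integrable_const _)]; simp

end Errors

/-! ### Central limit theorem for linear functionals of the estimator -/

section LeastSquaresCLT

theorem sum_pow_four_le {ι : Type*} [Fintype ι] (x : ι → ℝ) :
    (∑ i, x i) ^ 4 ≤ (Fintype.card ι : ℝ) ^ 3 * ∑ i, x i ^ 4 := by
  have h1 : (∑ i, x i) ^ 2 ≤ Fintype.card ι * ∑ i, x i ^ 2 := by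
    simpa using sq_sum_le_card_mul_sum_sq (s := Finset.univ) (f := x)
  have h2 : (∑ i, x i ^ 2) ^ 2 ≤ Fintype.card ι * ∑ i, (x i ^ 2) ^ 2 := by
    simpa using sq_sum_le_card_mul_sum_sq (s := Finset.univ) (f := fun i => x i ^ 2)
  calc (∑ i, x i) ^ 4 = ((∑ i, x i) ^ 2) ^ 2 := by ring
    _ ≤ (Fintype.card ι * ∑ i, x i ^ 2) ^ 2 := pow_le_pow_left₀ (sq_nonneg _) h1 2
    _ = (Fintype.card ι : ℝ) ^ 2 * (∑ i, x i ^ 2) ^ 2 := mul_pow _ _ _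
    _ ≤ (Fintype.card ι : ℝ) ^ 2 * (Fintype.card ι * ∑ i, (x i ^ 2) ^ 2) := by gcongr
    _ = _ := by simp only [← pow_mul]; ring

variable {Ω : Type*} [MeasurableSpace Ω] {P : Measure Ω} {a c p : ℕ}
  {ε : Fin a → ℕ → Ω → Fin p → ℝ} {Sig : Fin a → Matrix (Fin p) (Fin p) ℝ} {K : ℝ}

theorem IsErrorArray.integrable_linear_pow_four (hε : IsErrorArray P ε Sig K) (i : Fin a) (j : ℕ)
    (q : Fin p → ℝ) : Integrable (fun ω => (∑ k, q k * ε i j ω k) ^ 4) P := by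
  have hi : Integrable (fun ω => (p : ℝ) ^ 3 * ∑ k, (q k * ε i j ω k) ^ 4) P := by
    simp only [mul_pow]
    exact (integrable_finsetSum _ fun k _ =>
      (hε.integrable_pow_four i j k).const_mul _).const_mul _
  have hm : Measurable fun ω => (∑ k, q k * ε i j ω k) ^ 4 :=
    (Finset.measurable_sum _ fun k _ => (hε.measurable_apply i j k).const_mul _).pow_const 4
  refine hi.mono' hm.aestronglyMeasurable (Eventually.of_forall fun ω => ?_)
  rw [Real.norm_eq_abs, abs_of_nonneg (by positivity)]
  simpa using sum_pow_four_le fun k => q k * ε i j ω k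

theorem IsErrorArray.integral_linear_pow_four_le [IsProbabilityMeasure P]
    (hε : IsErrorArray P ε Sig K) (i : Fin a) (j : ℕ) (q : Fin p → ℝ) :
    ∫ ω, (∑ k, q k * ε i j ω k) ^ 4 ∂P ≤ (p : ℝ) ^ 3 * K * ∑ k, q k ^ 4 := by
  have hi : ∀ k, Integrable (fun ω => q k ^ 4 * ε i j ω k ^ 4) P := fun k =>
    (hε.integrable_pow_four i j k).const_mul _
  calc ∫ ω, (∑ k, q k * ε i j ω k) ^ 4 ∂P
      ≤ ∫ ω, (p : ℝ) ^ 3 * ∑ k, q k ^ 4 * ε i j ω k ^ 4 ∂P := by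
        refine integral_mono (hε.integrable_linear_pow_four i j q)
          ((integrable_finsetSum _ fun k _ => hi k).const_mul _) fun ω => ?_
        simpa [mul_pow] using sum_pow_four_le fun k => q k * ε i j ω k
    _ = (p : ℝ) ^ 3 * ∑ k, q k ^ 4 * ∫ ω, ε i j ω k ^ 4 ∂P := by
      rw [integral_const_mul, integral_finsetSum _ fun k _ => hi k]
      simp only [integral_const_mul]
    _ ≤ (p : ℝ) ^ 3 * ∑ k, q k ^ 4 * K := by
      gcongr with k
      exact hε.pow_four_le i j k
    _ = _ := by rw [← Finset.sum_mul]; ring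

theorem IsErrorArray.integral_linear_sq [IsProbabilityMeasure P]
    (hε : IsErrorArray P ε Sig K) (i : Fin a) (j : ℕ) (q : Fin p → ℝ) :
    ∫ ω, (∑ k, q k * ε i j ω k) ^ 2 ∂P = ∑ k, ∑ l, q k * q l * Sig i k l := by
  have hi : ∀ k l, Integrable (fun ω => q k * q l * (ε i j ω k * ε i j ω l)) P := fun k l =>
    ((hε.memLp i j k).integrable_mul (hε.memLp i j l)).const_mul _
  have h : ∀ ω, (∑ k, q k * ε i j ω k) ^ 2 =
      ∑ k, ∑ l, q k * q l * (ε i j ω k * ε i j ω l) := fun ω => by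
    rw [sq, Finset.sum_mul_sum]
    exact Finset.sum_congr rfl fun k _ => Finset.sum_congr rfl fun l _ => by ring
  simp only [h]
  rw [integral_finsetSum _ fun k _ => integrable_finsetSum _ fun l _ => hi k l]
  refine Finset.sum_congr rfl fun k _ => ?_
  rw [integral_finsetSum _ fun l _ => hi k l]
  exact Finset.sum_congr rfl fun l _ => by rw [integral_const_mul, hε.cov]

variable {n : ℕ → Fin a → ℕ} {z : Fin a → ℕ → Fin c → ℝ}
  {Γ : Fin a → Matrix (Fin a ⊕ Fin c) (Fin a ⊕ Fin c) ℝ}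

/-- The limit covariance matrix of the normalized estimator of the adjusted means. -/
def limitCovMean (Γ : Fin a → Matrix (Fin a ⊕ Fin c) (Fin a ⊕ Fin c) ℝ)
    (Sig : Fin a → Matrix (Fin p) (Fin p) ℝ) : Matrix (Fin a × Fin p) (Fin a × Fin p) ℝ :=
  (limitCov Γ Sig).submatrix (fun r => (Sum.inl r.1, r.2)) fun r => (Sum.inl r.1, r.2)

/-- The weight of the error of subject `s` in the linear functional `u` of the normalized
estimation error of the adjusted means. -/
def lsWeight (N : ℕ) (n : Fin a → ℕ) (z : Fin a → ℕ → Fin c → ℝ) (u : Fin a × Fin p → ℝ)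
    (s : Subject n) (k : Fin p) : ℝ :=
  √N * ∑ i, u (i, k) * lsCoef n z (Sum.inl i) s

theorem tendsto_sum_lsWeight_cov
    (hG : ∀ i, Tendsto (fun N : ℕ => (N : ℝ)⁻¹ • groupGram (n N) z i) atTop (𝓝 (Γ i)))
    (hΓ : (∑ i, Γ i).det ≠ 0) (Sig : Fin a → Matrix (Fin p) (Fin p) ℝ) (u : Fin a × Fin p → ℝ) :
    Tendsto (fun N : ℕ => ∑ s : Subject (n N), ∑ k, ∑ l,
      lsWeight N (n N) z u s k * lsWeight N (n N) z u s l * Sig s.1 k l) atTop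
      (𝓝 (u ⬝ᵥ (limitCovMean Γ Sig *ᵥ u))) := by
  have h1 : Tendsto (fun N : ℕ => ∑ i, ∑ k, ∑ i', ∑ l, u (i, k) * u (i', l) * ∑ s,
      (N : ℝ) * (lsCoef (n N) z (Sum.inl i) s * lsCoef (n N) z (Sum.inl i') s) * Sig s.1 k l) atTop
      (𝓝 (∑ i, ∑ k, ∑ i', ∑ l, u (i, k) * u (i', l) *
        limitCov Γ Sig (Sum.inl i, k) (Sum.inl i', l))) :=
    tendsto_finsetSum _ fun i _ => tendsto_finsetSum _ fun k _ => tendsto_finsetSum _ fun i' _ =>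
      tendsto_finsetSum _ fun l _ => (tendsto_sum_lsCoef_cov hG hΓ Sig _ _ k l).const_mul _
  have h2 : u ⬝ᵥ (limitCovMean Γ Sig *ᵥ u) = ∑ i, ∑ k, ∑ i', ∑ l, u (i, k) * u (i', l) *
      limitCov Γ Sig (Sum.inl i, k) (Sum.inl i', l) := by
    simp only [dotProduct, Matrix.mulVec, Fintype.sum_prod_type, limitCovMean,
      Matrix.submatrix_apply, Finset.mul_sum]
    refine Finset.sum_congr rfl fun i _ => Finset.sum_congr rfl fun k _ =>
      Finset.sum_congr rfl fun i' _ => Finset.sum_congr rfl fun l _ => by ring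
  rw [h2]
  refine h1.congr fun N => ?_
  have hN : √(N : ℝ) * √N = N := Real.mul_self_sqrt (by positivity)
  have h3 : ∀ (s : Subject (n N)) (k l : Fin p),
      lsWeight N (n N) z u s k * lsWeight N (n N) z u s l * Sig s.1 k l =
      ∑ i, ∑ i', u (i, k) * u (i', l) * ((N : ℝ) *
        (lsCoef (n N) z (Sum.inl i) s * lsCoef (n N) z (Sum.inl i') s) * Sig s.1 k l) := by
    intro s k l
    rw [lsWeight, lsWeight, mul_mul_mul_comm, hN, Finset.sum_mul_sum, Finset.mul_sum,
      Finset.sum_mul]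
    refine Finset.sum_congr rfl fun i _ => ?_
    rw [Finset.mul_sum, Finset.sum_mul]
    exact Finset.sum_congr rfl fun i' _ => by ring
  simp only [h3, Finset.mul_sum]
  have e1 : ∀ F : Fin a → Fin p → Fin a → Fin p → Subject (n N) → ℝ,
      ∑ i, ∑ k, ∑ i', ∑ l, ∑ s, F i k i' l s = ∑ s, ∑ k, ∑ l, ∑ i, ∑ i', F i k i' l s := by
    intro F
    have c1 : ∀ i k, ∑ i', ∑ l, ∑ s, F i k i' l s = ∑ s, ∑ l, ∑ i', F i k i' l s := fun i k => by
      rw [Finset.sum_comm, Finset.sum_congr rfl fun l _ => Finset.sum_comm, Finset.sum_comm]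
    simp only [c1]
    have c2 : ∀ i, ∑ k, ∑ s, ∑ l, ∑ i', F i k i' l s = ∑ s, ∑ k, ∑ l, ∑ i', F i k i' l s :=
      fun i => Finset.sum_comm
    simp only [c2]
    rw [Finset.sum_comm]
    refine Finset.sum_congr rfl fun s _ => ?_
    rw [Finset.sum_comm]
    exact Finset.sum_congr rfl fun k _ => Finset.sum_comm
  exact e1 _

/-- Lyapunov's condition: the fourth powers are bounded by the largest `N lsCoef²`, which vanishes,
times the sum of all of them, which stays bounded. Cauchy–Schwarz over the groups separates the
factor `U` depending on `u`. -/
theorem tendsto_sum_lsWeight_pow_four (hn : ∀ N, ∑ i, n N i = N)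
    (hG : ∀ i, Tendsto (fun N : ℕ => (N : ℝ)⁻¹ • groupGram (n N) z i) atTop (𝓝 (Γ i)))
    (hΓ : (∑ i, Γ i).det ≠ 0) (u : Fin a × Fin p → ℝ) :
    Tendsto (fun N : ℕ => ∑ s : Subject (n N), ∑ k, lsWeight N (n N) z u s k ^ 4) atTop
      (𝓝 0) := by
  obtain ⟨R, hR, hbd⟩ := exists_sum_abs_lsCoef_bound hG hΓ
  set U : ℝ := ∑ k, (∑ i, u (i, k) ^ 2) ^ 2 with hU
  have hbound : ∀ η : ℝ, 0 < η → ∀ᶠ N : ℕ in atTop,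
      ∑ s : Subject (n N), ∑ k, lsWeight N (n N) z u s k ^ 4 ≤ U * (a * η * (a * R)) := by
    intro η hη
    filter_upwards [hbd, eventually_lsCoef_sq_le hn hG hΓ hη] with N hN hc
    set M : Subject (n N) → ℝ := fun s => ∑ i, (N : ℝ) * lsCoef (n N) z (Sum.inl i) s ^ 2 with hM
    have hM0 : ∀ s, 0 ≤ M s := fun s => Finset.sum_nonneg fun i _ => by positivity
    have hMη : ∀ s, M s ≤ a * η := fun s => by
      calc M s ≤ ∑ _i : Fin a, η := Finset.sum_le_sum fun i _ => hc (Sum.inl i) s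
        _ = a * η := by simp
    have hMR : ∑ s, M s ≤ a * R := by
      rw [hM, Finset.sum_comm]
      calc _ ≤ ∑ _i : Fin a, R := Finset.sum_le_sum fun i _ => by
            refine le_trans (Finset.sum_le_sum fun s _ => ?_) (hN (Sum.inl i) (Sum.inl i))
            rw [← sq]
            exact le_abs_self _
        _ = a * R := by simp
    have hq : ∀ s k, lsWeight N (n N) z u s k ^ 2 ≤ (∑ i, u (i, k) ^ 2) * M s := fun s k => by
      rw [lsWeight, mul_pow, Real.sq_sqrt (by positivity), hM]
      simp only
      rw [← Finset.mul_sum, mul_left_comm]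
      gcongr
      exact Finset.sum_mul_sq_le_sq_mul_sq _ _ _
    have hq4 : ∀ s k, lsWeight N (n N) z u s k ^ 4 ≤ (∑ i, u (i, k) ^ 2) ^ 2 * (a * η * M s) :=
      fun s k => by
        calc lsWeight N (n N) z u s k ^ 4 = (lsWeight N (n N) z u s k ^ 2) ^ 2 := by ring
          _ ≤ ((∑ i, u (i, k) ^ 2) * M s) ^ 2 := pow_le_pow_left₀ (sq_nonneg _) (hq s k) 2
          _ = (∑ i, u (i, k) ^ 2) ^ 2 * (M s * M s) := by ring
          _ ≤ _ := by
            gcongr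
            exact hMη s
    calc _ ≤ ∑ s, ∑ k, (∑ i, u (i, k) ^ 2) ^ 2 * (a * η * M s) :=
          Finset.sum_le_sum fun s _ => Finset.sum_le_sum fun k _ => hq4 s k
      _ = U * (a * η * ∑ s, M s) := by
        simp only [← Finset.sum_mul, ← Finset.mul_sum, hU]
      _ ≤ _ := by
        have hU0 : 0 ≤ U := Finset.sum_nonneg fun k _ => sq_nonneg _
        gcongr
  have hlim : Tendsto (fun η : ℝ => U * (a * η * (a * R))) (𝓝[>] 0) (𝓝 0) := by
    have : Continuous fun η : ℝ => U * (a * η * (a * R)) := by fun_prop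
    have h0 := this.tendsto 0
    simp only [mul_zero, zero_mul] at h0
    exact h0.mono_left nhdsWithin_le_nhds
  rw [Metric.tendsto_atTop']
  intro δ hδ
  obtain ⟨η, hη, hηδ⟩ := ((hlim.eventually (gt_mem_nhds hδ)).and self_mem_nhdsWithin).exists
  obtain ⟨N₀, hN₀⟩ := eventually_atTop.mp (hbound η hηδ)
  refine ⟨N₀, fun N hN => ?_⟩
  rw [Real.dist_0_eq_abs, abs_of_nonneg
    (Finset.sum_nonneg fun s _ => Finset.sum_nonneg fun k _ => by positivity)]
  exact (hN₀ N hN.le).trans_lt hη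

theorem tendsto_charFun_lsWeight [IsProbabilityMeasure P]
    (hε : IsErrorArray P ε Sig K) (hn : ∀ N, ∑ i, n N i = N)
    (hG : ∀ i, Tendsto (fun N : ℕ => (N : ℝ)⁻¹ • groupGram (n N) z i) atTop (𝓝 (Γ i)))
    (hΓ : (∑ i, Γ i).det ≠ 0) (u : Fin a × Fin p → ℝ) :
    Tendsto (fun N : ℕ => charFun (P.map fun ω => ∑ s : Subject (n N), ∑ k,
      lsWeight N (n N) z u s k * ε s.1 s.2 ω k) 1) atTop
      (𝓝 (Complex.exp (-((u ⬝ᵥ (limitCovMean Γ Sig *ᵥ u) : ℝ) : ℂ) / 2))) := by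
  refine tendsto_charFun_sum (S := fun N => Subject (n N))
    (ξ := fun N s ω => ∑ k, lsWeight N (n N) z u s k * ε s.1 s.2 ω k) (fun N s => ?_) (fun N => ?_)
    (fun N s => ?_) (fun N s => hε.integrable_linear_pow_four _ _ _) ?_ ?_
  · exact Finset.measurable_sum _ fun k _ => (hε.measurable_apply _ _ k).const_mul _
  · exact (hε.indep_subject (n N)).comp
      (fun s x => ∑ k, lsWeight N (n N) z u s k * x k) fun s => by fun_prop
  · rw [integral_finsetSum _ fun k _ =>
      ((hε.memLp s.1 s.2 k).integrable (by norm_num)).const_mul _]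
    exact Finset.sum_eq_zero fun k _ => by rw [integral_const_mul, hε.mean, mul_zero]
  · simp only [hε.integral_linear_sq]
    exact tendsto_sum_lsWeight_cov hG hΓ Sig u
  · have h := (tendsto_sum_lsWeight_pow_four hn hG hΓ u).const_mul ((p : ℝ) ^ 3 * K)
    rw [mul_zero] at h
    refine tendsto_of_tendsto_of_tendsto_of_le_of_le tendsto_const_nhds h
      (fun N => Finset.sum_nonneg fun s _ => integral_nonneg fun ω => by positivity) fun N => ?_
    simp only [Finset.mul_sum]
    refine Finset.sum_le_sum fun s _ => ?_
    rw [← Finset.mul_sum]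
    exact hε.integral_linear_pow_four_le _ _ _

end LeastSquaresCLT

/-! ### The Wald-type statistic as a quadratic form in the whitened errors -/

section QuadraticForm

variable {Ω : Type*} {a c p f : ℕ} {ε : Fin a → ℕ → Ω → Fin p → ℝ}
  {n : ℕ → Fin a → ℕ} {z : Fin a → ℕ → Fin c → ℝ}

/-- The linear image under `L` of the normalized error of the adjusted means estimator. -/
def normalizedError (ε : Fin a → ℕ → Ω → Fin p → ℝ) (n : ℕ → Fin a → ℕ)
    (z : Fin a → ℕ → Fin c → ℝ) (L : Matrix (Fin f) (Fin a × Fin p) ℝ) (N : ℕ) (ω : Ω) :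
    EuclideanSpace ℝ (Fin f) :=
  WithLp.toLp 2 fun r => ∑ s : Subject (n N), ∑ k, lsWeight N (n N) z (L r) s k * ε s.1 s.2 ω k

/-- The Cramér–Wold reduction: weights are linear in the functional, so projecting on `t` gives the
scalar sum for `Lᵀ t`. -/
theorem inner_normalizedError (L : Matrix (Fin f) (Fin a × Fin p) ℝ) (N : ℕ) (ω : Ω)
    (t : EuclideanSpace ℝ (Fin f)) :
    inner ℝ (normalizedError ε n z L N ω) t = ∑ s : Subject (n N), ∑ k,
      lsWeight N (n N) z (Lᵀ *ᵥ t.ofLp) s k * ε s.1 s.2 ω k := by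
  have h : ∀ (s : Subject (n N)) (k : Fin p), lsWeight N (n N) z (Lᵀ *ᵥ t.ofLp) s k =
      ∑ r, t r * lsWeight N (n N) z (L r) s k := fun s k => by
    simp only [lsWeight, Matrix.mulVec, dotProduct, Matrix.transpose_apply, Finset.mul_sum,
      Finset.sum_mul]
    rw [Finset.sum_comm]
    exact Finset.sum_congr rfl fun r _ => Finset.sum_congr rfl fun i _ => by ring
  simp only [h, EuclideanSpace.inner_eq_star_dotProduct, dotProduct, normalizedError, star_trivial,
    Finset.mul_sum, Finset.sum_mul]
  rw [Finset.sum_comm]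
  refine Finset.sum_congr rfl fun s _ => ?_
  rw [Finset.sum_comm]
  exact Finset.sum_congr rfl fun k _ => Finset.sum_congr rfl fun r _ => by ring

variable {μ : Fin a × Fin p → ℝ} {ν : Fin c × Fin p → ℝ} {Y : Fin a → ℕ → Ω → Fin p → ℝ}

/-- On the event that the whitened covariance estimator is invertible, the Wald-type statistic is
the corresponding quadratic form in the normalized estimation error. -/
theorem wald_eq_quadraticForm {T : Matrix (Fin a × Fin p) (Fin a × Fin p) ℝ}
    (hmodel : ∀ i j ω k, Y i j ω k = μ (i, k) + ∑ w, z i j w * ν (w, k) + ε i j ω k)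
    {L : Matrix (Fin f) (Fin a × Fin p) ℝ} (hLT : L * T = L)
    (hpinv : ∀ R : Matrix (Fin a × Fin p) (Fin a × Fin p) ℝ, (L * R * Lᵀ).det ≠ 0 →
      Tᵀ * pinv (T * R * T) * T = Lᵀ * (L * R * Lᵀ)⁻¹ * L)
    (hnull : T *ᵥ μ = 0) {N : ℕ} (hN : 0 < N)
    (hu : IsUnit ((design (n N) z)ᵀ * design (n N) z).det) {ω : Ω}
    (hdet : (L * ((N : ℝ) • sigmaHat (n N) z fun i j => Y i j ω) * Lᵀ).det ≠ 0) :
    wald T (n N) z (fun i j => Y i j ω) =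
      (normalizedError ε n z L N ω).ofLp ⬝ᵥ
        ((L * ((N : ℝ) • sigmaHat (n N) z fun i j => Y i j ω) * Lᵀ)⁻¹ *ᵥ
          (normalizedError ε n z L N ω).ofLp) := by
  have hN0 : (N : ℝ) ≠ 0 := by positivity
  set S := sigmaHat (n N) z fun i j => Y i j ω
  set M := L * S * Lᵀ with hM
  have hNM : L * ((N : ℝ) • S) * Lᵀ = (N : ℝ) • M := by
    rw [Matrix.mul_smul, Matrix.smul_mul]
  rw [hNM] at hdet ⊢
  have hMdet : M.det ≠ 0 := fun h => hdet (by rw [Matrix.det_smul, h, mul_zero])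
  have hinv : ((N : ℝ) • M)⁻¹ = (N : ℝ)⁻¹ • M⁻¹ := by
    refine Matrix.inv_eq_right_inv ?_
    rw [Matrix.smul_mul, Matrix.mul_smul, Matrix.mul_nonsing_inv _ (isUnit_iff_ne_zero.mpr hMdet),
      smul_smul, mul_inv_cancel₀ hN0, one_smul]
  -- The only use of the null hypothesis: `L = L T` removes the true mean, leaving pure error.
  have hLμ : L *ᵥ μ = 0 := by rw [← hLT, ← Matrix.mulVec_mulVec, hnull, Matrix.mulVec_zero]
  set x := muHat (n N) z fun i j => Y i j ω with hx
  have herr : (normalizedError ε n z L N ω).ofLp = √(N : ℝ) • (L *ᵥ x) := by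
    have hxr : x = μ + fun r => ∑ s : Subject (n N),
        lsCoef (n N) z (Sum.inl r.1) s * ε s.1 s.2 ω r.2 := by
      ext r
      rw [hx, muHat, ols_eq_add (fun i j k => hmodel i j ω k) hu]
      rfl
    rw [hxr, Matrix.mulVec_add, hLμ, zero_add]
    ext r
    simp only [normalizedError, lsWeight, Pi.smul_apply, smul_eq_mul, Matrix.mulVec, dotProduct,
      Fintype.sum_prod_type, Finset.mul_sum, Finset.sum_mul]
    have e1 : ∀ F : Subject (n N) → Fin p → Fin a → ℝ,
        ∑ s, ∑ k, ∑ i, F s k i = ∑ i, ∑ k, ∑ s, F s k i := fun F => by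
      rw [Finset.sum_comm, Finset.sum_congr rfl fun k _ => Finset.sum_comm, Finset.sum_comm]
    rw [e1]
    exact Finset.sum_congr rfl fun i _ => Finset.sum_congr rfl fun k _ =>
      Finset.sum_congr rfl fun s _ => by ring
  have hsq : √(N : ℝ) * √N = N := Real.mul_self_sqrt (by positivity)
  rw [herr, hinv, wald, hpinv S hMdet]
  simp only [Matrix.smul_mulVec, Matrix.mulVec_smul, dotProduct_smul, smul_dotProduct,
    smul_eq_mul]
  have hkey : x ⬝ᵥ ((Lᵀ * M⁻¹ * L) *ᵥ x) = (L *ᵥ x) ⬝ᵥ (M⁻¹ *ᵥ (L *ᵥ x)) := by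
    rw [← Matrix.mulVec_mulVec, ← Matrix.mulVec_mulVec, Matrix.dotProduct_mulVec x,
      Matrix.vecMul_transpose]
  rw [hkey, ← mul_assoc, ← mul_assoc]
  rw [show √(N : ℝ) * (N : ℝ)⁻¹ * √N = 1 by
    rw [mul_right_comm, hsq, mul_inv_cancel₀ hN0], one_mul]

end QuadraticForm

/-! ### Measurability of the statistic and asymptotic normality -/

section WaldStatistic

variable {Ω : Type*} [MeasurableSpace Ω] {P : Measure Ω} {a c p : ℕ}

theorem measurable_ols {y : Ω → Fin a → ℕ → Fin p → ℝ}
    (hy : ∀ i j k, Measurable fun ω => y ω i j k) (n : Fin a → ℕ) (z : Fin a → ℕ → Fin c → ℝ)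
    (r : (Fin a ⊕ Fin c) × Fin p) : Measurable fun ω => ols n z (y ω) r := by
  obtain ⟨b, k⟩ := r
  simp only [ols_apply]
  exact Finset.measurable_sum _ fun s _ => (hy _ _ _).const_mul _

theorem measurable_sigmaHat {y : Ω → Fin a → ℕ → Fin p → ℝ}
    (hy : ∀ i j k, Measurable fun ω => y ω i j k) (n : Fin a → ℕ) (z : Fin a → ℕ → Fin c → ℝ)
    (r r' : Fin a × Fin p) : Measurable fun ω => sigmaHat n z (y ω) r r' := by
  obtain ⟨i, k⟩ := r
  obtain ⟨i', l⟩ := r'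
  have hres : ∀ (s : Subject n) k, Measurable fun ω => residual n z (y ω) s k := fun s k => by
    simp only [residual_eq_sub_sum]
    exact (hy _ _ _).sub (Finset.measurable_sum _ fun b _ => (measurable_ols hy n z _).const_mul _)
  simp only [sigmaHat_apply]
  exact Finset.measurable_sum _ fun s _ => ((hres s k).mul (hres s l)).const_mul _

theorem measurable_wald {y : Ω → Fin a → ℕ → Fin p → ℝ}
    (hy : ∀ i j k, Measurable fun ω => y ω i j k) (n : Fin a → ℕ) (z : Fin a → ℕ → Fin c → ℝ)
    (T : Matrix (Fin a × Fin p) (Fin a × Fin p) ℝ) : Measurable fun ω => wald T n z (y ω) := by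
  have hμ : ∀ r, Measurable fun ω => muHat n z (y ω) r := fun r => measurable_ols hy n z _
  have hT : ∀ (M : Matrix (Fin a × Fin p) (Fin a × Fin p) ℝ) r r',
      Measurable fun _ : Ω => M r r' := fun M r r' => measurable_const
  simp only [wald, dotProduct, Matrix.mulVec]
  refine Finset.measurable_sum _ fun r _ => (hμ r).mul
    (Finset.measurable_sum _ fun r' _ => Measurable.mul ?_ (hμ r'))
  exact measurable_mul_apply (measurable_mul_apply (hT _) (measurable_pinv_apply
    (measurable_mul_apply (measurable_mul_apply (hT _) (measurable_sigmaHat hy n z)) (hT _))))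
    (hT _) r r'

variable {ε : Fin a → ℕ → Ω → Fin p → ℝ} {Sig : Fin a → Matrix (Fin p) (Fin p) ℝ} {K : ℝ}
  {n : ℕ → Fin a → ℕ} {z : Fin a → ℕ → Fin c → ℝ}
  {Γ : Fin a → Matrix (Fin a ⊕ Fin c) (Fin a ⊕ Fin c) ℝ}
  {f : ℕ}

theorem measurable_normalizedError (hε : IsErrorArray P ε Sig K)
    (L : Matrix (Fin f) (Fin a × Fin p) ℝ) (N : ℕ) :
    Measurable (normalizedError ε n z L N) := by
  refine (WithLp.measurable_toLp 2 _).comp (measurable_pi_lambda _ fun r => ?_)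
  exact Finset.measurable_sum _ fun s _ => Finset.measurable_sum _ fun k _ =>
    (hε.measurable_apply _ _ k).const_mul _

/-- Asymptotic normality of the least squares estimator of the adjusted means. -/
theorem tendstoInDistribution_normalizedError [IsProbabilityMeasure P]
    (hε : IsErrorArray P ε Sig K) (hn : ∀ N, ∑ i, n N i = N)
    (hG : ∀ i, Tendsto (fun N : ℕ => (N : ℝ)⁻¹ • groupGram (n N) z i) atTop (𝓝 (Γ i)))
    (hΓ : (∑ i, Γ i).det ≠ 0) {L : Matrix (Fin f) (Fin a × Fin p) ℝ}
    (hL : L * limitCovMean Γ Sig * Lᵀ = 1) :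
    TendstoInDistribution (normalizedError ε n z L) atTop
      (id : EuclideanSpace ℝ (Fin f) → EuclideanSpace ℝ (Fin f)) (fun _ => P)
      (stdGaussian (EuclideanSpace ℝ (Fin f))) where
  forall_aemeasurable N := (measurable_normalizedError hε L N).aemeasurable
  aemeasurable_limit := aemeasurable_id
  tendsto := by
    refine ProbabilityMeasure.tendsto_of_tendsto_charFun fun t => ?_
    simp only [ProbabilityMeasure.coe_mk, Measure.map_id, charFun_stdGaussian]
    -- Whitening makes the limit variance in direction `t` equal to `‖t‖²`, the exponent of the
    -- standard Gaussian characteristic function.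
    have hnorm : (Lᵀ *ᵥ t.ofLp) ⬝ᵥ (limitCovMean Γ Sig *ᵥ (Lᵀ *ᵥ t.ofLp)) = ‖t‖ ^ 2 := by
      rw [EuclideanSpace.real_norm_sq_eq, Matrix.mulVec_transpose, ← Matrix.dotProduct_mulVec,
        ← Matrix.mulVec_transpose, Matrix.mulVec_mulVec, Matrix.mulVec_mulVec, hL,
        Matrix.one_mulVec, dotProduct]
      exact Finset.sum_congr rfl fun i _ => (sq _).symm
    have h := tendsto_charFun_lsWeight hε hn hG hΓ (Lᵀ *ᵥ t.ofLp)
    rw [hnorm] at h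
    push_cast at h
    refine h.congr fun N => ?_
    rw [charFun_apply_real, charFun_apply, integral_map
      (measurable_normalizedError hε L N).aemeasurable (by fun_prop), integral_map
      (Measurable.aemeasurable (Finset.measurable_sum _ fun s _ => Finset.measurable_sum _
        fun k _ => (hε.measurable_apply _ _ k).const_mul _)) (by fun_prop)]
    simp [inner_normalizedError]

theorem map_stdGaussian_sum_sq (f : ℕ) :
    (stdGaussian (EuclideanSpace ℝ (Fin f))).map (fun x => ∑ i, x i ^ 2) = chiSquared f := by
  rw [← map_pi_eq_stdGaussian, Measure.map_map (by fun_prop) (by fun_prop)]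
  rfl

end WaldStatistic

/-! ### Slutsky's theorem and the chi-squared limit -/

section ChiSquaredLimit

/-- The inverse of the congruence transform `L R L'`. -/
def compressedInv {ι κ : Type*} [Fintype ι] [Fintype κ] [DecidableEq κ] (L : Matrix κ ι ℝ)
    (R : ι → ι → ℝ) : Matrix κ κ ℝ :=
  (L * Matrix.of R * Lᵀ)⁻¹

theorem measurable_compressedInv {α ι κ : Type*} [MeasurableSpace α] [Fintype ι] [Fintype κ]
    [DecidableEq κ] {S : α → ι → ι → ℝ} (L : Matrix κ ι ℝ)
    (hS : ∀ r r', Measurable fun x => S x r r') :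
    Measurable (β := κ → κ → ℝ) fun x => compressedInv L (S x) := by
  have hLS : ∀ r r', Measurable fun x => (L * Matrix.of (S x)) r r' :=
    measurable_mul_apply (A := fun _ => L) (B := fun x => Matrix.of (S x))
      (fun _ _ => measurable_const) hS
  have hLSL : ∀ r r', Measurable fun x => (L * Matrix.of (S x) * Lᵀ) r r' :=
    measurable_mul_apply (B := fun _ => Lᵀ) hLS fun _ _ => measurable_const
  exact measurable_pi_lambda _ fun r => measurable_pi_lambda _ fun r' =>
    measurable_inv_apply hLSL r r'

variable {Ω : Type*} [MeasurableSpace Ω] {P : Measure Ω} [IsProbabilityMeasure P] {a c p : ℕ}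
  {ε : Fin a → ℕ → Ω → Fin p → ℝ} {Sig : Fin a → Matrix (Fin p) (Fin p) ℝ} {K : ℝ}
  {n : ℕ → Fin a → ℕ} {z : Fin a → ℕ → Fin c → ℝ}
  {Γ : Fin a → Matrix (Fin a ⊕ Fin c) (Fin a ⊕ Fin c) ℝ}
  {μ : Fin a × Fin p → ℝ} {ν : Fin c × Fin p → ℝ} {Y : Fin a → ℕ → Ω → Fin p → ℝ}

/-- The Wald-type statistic of an orthogonal projector `T` with `T μ = 0` converges in
distribution to the chi-squared distribution with `rank T` degrees of freedom. -/
theorem tendstoInDistribution_wald (hε : IsErrorArray P ε Sig K)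
    (hSig : ∀ i, (Sig i).PosDef)
    (hmodel : ∀ i j ω k, Y i j ω k = μ (i, k) + ∑ w, z i j w * ν (w, k) + ε i j ω k)
    (hn : ∀ N, ∑ i, n N i = N)
    (hG : ∀ i, Tendsto (fun N : ℕ => (N : ℝ)⁻¹ • groupGram (n N) z i) atTop (𝓝 (Γ i)))
    (hΓ : (∑ i, Γ i).det ≠ 0) {T : Matrix (Fin a × Fin p) (Fin a × Fin p) ℝ}
    (hT : Tᵀ = T) (hTT : T * T = T) (hnull : T *ᵥ μ = 0) :
    TendstoInDistribution (fun N ω => wald T (n N) z (fun i j => Y i j ω))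
      atTop (id : ℝ → ℝ) (fun _ => P) (chiSquared T.rank) := by
  have hV : (limitCovMean Γ Sig).PosDef :=
    (posDef_limitCov hΓ (posSemidef_of_tendsto_groupGram hG) hSig).submatrix (by
      rintro ⟨i, k⟩ ⟨i', k'⟩ h
      simpa using h)
  obtain ⟨L, hL, hLT, hpinv⟩ := exists_whitening hT hTT hV
  have hY : ∀ i j k, Measurable fun ω => Y i j ω k := fun i j k => by
    simp only [hmodel]
    exact (hε.measurable_apply i j k).const_add _
  let S : ℕ → Ω → Fin a × Fin p → Fin a × Fin p → ℝ := fun (N : ℕ) ω r r' =>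
    (N : ℝ) * sigmaHat (n N) z (fun i j => Y i j ω) r r'
  have hS : TendstoInMeasure P S atTop fun _ => limitCovMean Γ Sig :=
    tendstoInMeasure_pi_const fun r => tendstoInMeasure_pi_const fun r' =>
      tendstoInMeasure_sigmaHat hε hmodel hn hG hΓ r.1 r'.1 r.2 r'.2
  have hcont : Continuous fun R : Matrix (Fin a × Fin p) (Fin a × Fin p) ℝ => L * R * Lᵀ :=
    (continuous_const.matrix_mul continuous_id).matrix_mul continuous_const
  let g : (Fin a × Fin p → Fin a × Fin p → ℝ) → Fin T.rank → Fin T.rank → ℝ :=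
    compressedInv L
  have hdet1 : (L * limitCovMean Γ Sig * Lᵀ).det ≠ 0 := by rw [hL]; simp
  have hg : ContinuousAt g (limitCovMean Γ Sig) :=
    ContinuousAt.comp (f := fun R : Matrix (Fin a × Fin p) (Fin a × Fin p) ℝ => L * R * Lᵀ)
      (continuousAt_matrix_inv hdet1) hcont.continuousAt
  have hgV : g (limitCovMean Γ Sig) = (1 : Matrix (Fin T.rank) (Fin T.rank) ℝ) := by
    change (L * limitCovMean Γ Sig * Lᵀ)⁻¹ = 1
    rw [hL, inv_one]
  have hR : TendstoInMeasure P (fun N ω => g (S N ω)) atTop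
      fun _ => (1 : Matrix (Fin T.rank) (Fin T.rank) ℝ) := by
    have := tendstoInMeasure_continuousAt_comp hS hg
    rwa [hgV] at this
  have hSm : ∀ N r r', Measurable fun ω => S N ω r r' := fun N r r' =>
    (measurable_sigmaHat (y := fun ω i j => Y i j ω) hY (n N) z r r').const_mul _
  have hRm : ∀ N, Measurable fun ω => g (S N ω) := fun N =>
    measurable_compressedInv L (hSm N)
  -- Jointly continuous in the vector and the matrix entries, so Slutsky's theorem applies with the
  -- matrix converging in probability to the identity.
  let Q : EuclideanSpace ℝ (Fin T.rank) × (Fin T.rank → Fin T.rank → ℝ) → ℝ := fun x =>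
    ∑ i, x.1 i * ∑ j, x.2 i j * x.1 j
  have hQ : Continuous Q := by fun_prop
  have hslutsky := TendstoInDistribution.continuous_comp_prodMk_of_tendstoInMeasure_const hQ
    (tendstoInDistribution_normalizedError hε hn hG hΓ hL) hR fun N => (hRm N).aemeasurable
  have hWm : ∀ N, Measurable fun ω => wald T (n N) z (fun i j => Y i j ω) := fun N =>
    measurable_wald (y := fun ω i j => Y i j ω) hY (n N) z T
  have hev : Tendsto (fun N => P {ω | S N ω ∉
      {R : Matrix (Fin a × Fin p) (Fin a × Fin p) ℝ | (L * R * Lᵀ).det ≠ 0}}) atTop (𝓝 0) :=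
    tendsto_measure_notMem_of_tendstoInMeasure hS
      ((Continuous.matrix_det hcont).continuousAt.eventually_ne hdet1)
  -- For all large `N` the statistic and the quadratic form agree exactly off the event that the
  -- compressed covariance estimator is singular, and the probability of that event vanishes.
  have hdiff : TendstoInMeasure P ((fun N ω => wald T (n N) z (fun i j => Y i j ω)) -
      fun N ω => Q (normalizedError ε n z L N ω, g (S N ω))) atTop 0 := by
    intro δ hδ
    refine tendsto_of_tendsto_of_tendsto_of_le_of_le' tendsto_const_nhds hev
      (Eventually.of_forall fun N => zero_le) ?_
    filter_upwards [eventually_isUnit_gram hG hΓ, eventually_gt_atTop 0] with N hu hN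
    refine measure_mono fun ω hω hdet => ?_
    have heq := wald_eq_quadraticForm hmodel hLT hpinv hnull hN hu hdet
    have hzero : wald T (n N) z (fun i j => Y i j ω) -
        Q (normalizedError ε n z L N ω, g (S N ω)) = 0 := by
      rw [heq]
      exact sub_self _
    simp only [Set.mem_ofPred_eq, Pi.sub_apply, Pi.zero_apply, hzero, edist_self] at hω
    exact absurd hω (not_le.mpr hδ)
  have hfin := tendstoInDistribution_of_tendstoInMeasure_sub _ _ hslutsky hdiff
    fun N => (hWm N).aemeasurable
  refine ⟨hfin.forall_aemeasurable, aemeasurable_id, ?_⟩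
  -- At the identity matrix the quadratic form is the sum of squares of the coordinates.
  have hlaw : (stdGaussian (EuclideanSpace ℝ (Fin T.rank))).map
      (fun x => Q (id x, (1 : Matrix (Fin T.rank) (Fin T.rank) ℝ))) =
      (chiSquared T.rank).map id := by
    rw [Measure.map_id, ← map_stdGaussian_sum_sq]
    congr 1
    funext x
    simp [Q, Matrix.one_apply, sq]
  have h := hfin.tendsto
  convert h using 3
  exact congrArg 𝓝 (Subtype.ext hlaw.symm)

end ChiSquaredLimit

end Mancova

end

theorem theorem1 {Ω : Type*} [MeasurableSpace Ω] (P : Measure Ω) [IsProbabilityMeasure P]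
    (a p c : ℕ)
    -- group sizes, with total sample size `N`
    (n : ℕ → Fin a → ℕ) (hn : ∀ N, ∑ i, n N i = N)
    -- fixed covariates, adjusted means, regression coefficients, errors and outcomes
    (z : Fin a → ℕ → Fin c → ℝ) (μ : Fin a × Fin p → ℝ) (ν : Fin c × Fin p → ℝ)
    (ε Y : Fin a → ℕ → Ω → Fin p → ℝ)
    (hmodel : ∀ i j ω k, Y i j ω k = μ (i, k) + ∑ w, z i j w * ν (w, k) + ε i j ω k)
    -- errors: independent, centered, group-specific covariance, bounded fourth moments
    (Sig : Fin a → Matrix (Fin p) (Fin p) ℝ)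
    (hmeas : ∀ i j, Measurable (ε i j))
    (hindep : iIndepFun (fun s : Fin a × ℕ => ε s.1 s.2) P)
    (hmean : ∀ i j k, P[fun ω => ε i j ω k] = 0)
    (hcov : ∀ i j k l, cov[fun ω => ε i j ω k, fun ω => ε i j ω l; P] = Sig i k l)
    (hfourth : ∃ C₁ : ℝ, ∀ i j k, Integrable (fun ω => ε i j ω k ^ 4) P ∧
      P[fun ω => ε i j ω k ^ 4] ≤ C₁)
    -- positive definite group covariance matrices
    (hSig : ∀ i, (Sig i).PosDef)
    -- convergence of the group size proportions
    (κ : Fin a → ℝ) (hκ : ∀ i, 0 < κ i)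
    (hsize : ∀ i, Tendsto (fun N : ℕ => (N : ℝ) / n N i) atTop (𝓝 (κ i)))
    -- full column rank, in finite samples and in the limit
    (hrank : ∀ᶠ N in atTop, LinearIndependent ℝ (Mancova.design (n N) z).col)
    (m : Fin a → Fin c → ℝ) (Ξ : Fin a → Matrix (Fin c) (Fin c) ℝ)
    (hlimit : (Mancova.limitGram κ m Ξ).det ≠ 0)
    -- convergence of the first and second moments of the covariates
    (hfirst : ∀ i w, Tendsto
      (fun N => (n N i : ℝ)⁻¹ * ∑ j ∈ Finset.range (n N i), z i j w) atTop (𝓝 (m i w)))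
    (hsecond : ∀ i w w', Tendsto
      (fun N => (n N i : ℝ)⁻¹ * ∑ j ∈ Finset.range (n N i), z i j w * z i j w')
      atTop (𝓝 (Ξ i w w')))
    -- null hypothesis `T μ = 0`, with `T` the projector of a matrix `H`
    (q : ℕ) (H : Matrix (Fin q) (Fin a × Fin p) ℝ)
    (hnull : Mancova.hypProj H *ᵥ μ = 0) :
    TendstoInDistribution
      (fun N ω => Mancova.wald (Mancova.hypProj H) (n N) z (fun i j => Y i j ω))
      atTop (id : ℝ → ℝ) (fun _ => P) (Mancova.chiSquared (Mancova.hypProj H).rank) := by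
  obtain ⟨K, hε⟩ := Mancova.isErrorArray_of_moments hmeas hindep hmean hcov hfourth
  exact Mancova.tendstoInDistribution_wald hε hSig hmodel hn
    (Mancova.tendsto_groupGram hκ hsize hfirst hsecond)
    (by rwa [Mancova.sum_limitGroupGram]) (Mancova.hypProj_transpose H)
    (Mancova.hypProj_mul_self H) hnull
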